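/- **Setting.** Let $T,n\ge 0$ be integers and let $\mathbf e_0,\dots,\mathbf e_{T-1}$ be independent random vectors in $\mathbb R^n$ on a probability space, each with an absolutely continuous law, finite second moments and positive definite covariance matrix. Let $s_0,\dots,s_{T-1}>1$, $W\in\mathbb R$ and $\gamma_t^\pm\in\mathbb R$. Put $\mathbf P_t=\mathbf e_t-s_t\mathbf 1$, $\rho_t=\prod_{j=t}^{T-1}s_j$ ($\rho_T=1$), $\mathcal F_t=\sigma(\mathbf e_0,\dots,\mathbf e_{t-1})$. The wealth under a Markov policy $\mathbf u_t=\mathbf u_t(X_t)$, with measurable $\mathbf u_t:\mathbb R\to\mathbb R^n$, satisfies $X_{t+1}=s_tX_t+\mathbf P_t'\mathbf u_t$. The risk aversion is $\gamma_t(x)=\gamma_t^+(x-\rho_t^{-1}W)$ if $x\ge\rho_t^{-1}W$ and $\gamma_t(x)=-\gamma_t^-(x-\rho_t^{-1}W)$ if $x<\rho_t^{-1}W$. A policy $\mathbf u$ is *time consistent* if for every $t<T$, every square integrable $\mathcal F_t$-measurable wealth $X_t$ and every measurable $\mathbf v:\mathbb R\to\mathbb R^n$ with $\mathbf v(X_t)$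 square integrable, almost surely the value of $$\mathrm{Var}(X_T\mid X_t)-\gamma_t(X_t)\,\mathbb E[X_T\mid X_t]$$ when $\mathbf u_t,\mathbf u_{t+1},\dots,\mathbf u_{T-1}$ is followed is at most its value when $\mathbf v,\mathbf u_{t+1},\dots,\mathbf u_{T-1}$ is followed. **Recursion.** Let $a_T^\pm=b_T^\pm=0$. Given $a_{t+1}^\pm,b_{t+1}^\pm$, write $\rho=\rho_{t+1}$, $R=R_t(\mathbf K)=s_t+\mathbf P_t'\mathbf K$ and $$A_t^+(\mathbf K)=a_{t+1}^+\mathbb E[R1_{\{R\ge0\}}]+a_{t+1}^-\mathbb E[R1_{\{R<0\}}],\qquad A_t^-(\mathbf K)=a_{t+1}^+\mathbb E[R1_{\{R\le0\}}]+a_{t+1}^-\mathbb E[R1_{\{R>0\}}],$$ $$\begin{aligned}F_t^+(\mathbf K)={}&\rho^2\mathbf K'\mathrm{Cov}(\mathbf P_t)\mathbf K+(2\rho a_{t+1}^++b_{t+1}^+)\mathbb E[R^21_{\{R\ge0\}}]+(2\rho a_{t+1}^-+b_{t+1}^-)\mathbb E[R^21_{\{R<0\}}]\\&-A_t^+(\mathbf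 K)^2-2\rho A_t^+(\mathbf K)\,\mathbb E[R]-\gamma_t^+A_t^+(\mathbf K)-\rho\gamma_t^+\mathbb E[R],\end{aligned}$$ $$\begin{aligned}F_t^-(\mathbf K)={}&\rho^2\mathbf K'\mathrm{Cov}(\mathbf P_t)\mathbf K+(2\rho a_{t+1}^++b_{t+1}^+)\mathbb E[R^21_{\{R\le0\}}]+(2\rho a_{t+1}^-+b_{t+1}^-)\mathbb E[R^21_{\{R>0\}}]\\&-A_t^-(\mathbf K)^2-2\rho A_t^-(\mathbf K)\,\mathbb E[R]+\gamma_t^-A_t^-(\mathbf K)+\rho\gamma_t^-\mathbb E[R].\end{aligned}$$ Let $\mathbf K_t^\pm$ be a global minimizer of $F_t^\pm$ over $\mathbb R^n$ and put $a_t^\pm=\rho\,\mathbb E[\mathbf P_t]'\mathbf K_t^\pm+A_t^\pm(\mathbf K_t^\pm)$ and, with $R^\pm=R_t(\mathbf K_t^\pm)$ and $Q^\pm=\mathbf P_t'\mathbf K_t^\pm$, $$\begin{aligned}b_t^+={}&\rho^2\mathbb E[(Q^+)^2]+2\rho a_{t+1}^+\mathbb E[R^+Q^+1_{\{R^+\ge0\}}]+2\rho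 a_{t+1}^-\mathbb E[R^+Q^+1_{\{R^+<0\}}]\\&+b_{t+1}^+\mathbb E[(R^+)^21_{\{R^+\ge0\}}]+b_{t+1}^-\mathbb E[(R^+)^21_{\{R^+<0\}}],\\ b_t^-={}&\rho^2\mathbb E[(Q^-)^2]+2\rho a_{t+1}^+\mathbb E[R^-Q^-1_{\{R^-\le0\}}]+2\rho a_{t+1}^-\mathbb E[R^-Q^-1_{\{R^->0\}}]\\&+b_{t+1}^+\mathbb E[(R^-)^21_{\{R^-\le0\}}]+b_{t+1}^-\mathbb E[(R^-)^21_{\{R^->0\}}].\end{aligned}$$ **Theorem.** Minimizers $\mathbf K_t^\pm$ and parameters $a_t^\pm,b_t^\pm$ as above exist. For every such choice: 1. The policy $$\mathbf u_t^{TC}=\mathbf K_t^+(X_t-\rho_t^{-1}W)1_{\{X_t\ge\rho_t^{-1}W\}}+\mathbf K_t^-(X_t-\rho_t^{-1}W)1_{\{X_t<\rho_t^{-1}W\}},\qquad t=0,\dots,T-1,$$ is time consistent. If, for every $t<T$, $\mathbf K_t^+$ and $\mathbf K_t^-$ are the only minimizers of $F_t^+$ and $F_t^-$, it is the only time-consistent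 policy. 2. $b_t^\pm-(a_t^\pm)^2\ge0$ for $t=0,\dots,T$. 3. Starting from any deterministic $X_0\in\mathbb R$ and following $\mathbf u^{TC}$, the terminal wealth $X_T$ is square integrable and $$\mathbb E[X_T]=\rho_0X_0+\big(a_0^+1_{\{X_0\ge\rho_0^{-1}W\}}+a_0^-1_{\{X_0<\rho_0^{-1}W\}}\big)(X_0-\rho_0^{-1}W),$$ $$\mathrm{Var}(X_T)=\Big[(b_0^+-(a_0^+)^2)1_{\{X_0\ge\rho_0^{-1}W\}}+(b_0^--(a_0^-)^2)1_{\{X_0<\rho_0^{-1}W\}}\Big](X_0-\rho_0^{-1}W)^2 .$$ -/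

import Mathlib

open MeasureTheory ProbabilityTheory
open scoped Matrix

/-- The data of the multi-period portfolio problem: the horizon `T`, the riskless returns `s t`, the
random return vectors `e t` of the `n` risky assets, the investment target `W`, and the risk
aversion coefficients `γp t` (surplus side) and `γm t` (shortage side). Only `t < T` matters. -/
structure PortfolioModel (Ω : Type*) (n : ℕ) where
  T : ℕ
  s : ℕ → ℝ
  e : ℕ → Ω → Fin n → ℝ
  W : ℝ
  γp : ℕ → ℝ
  γm : ℕ → ℝ

/-- A (candidate) family of investment funds `K_t^±` and parameters `a_t^±`, `b_t^±`. -/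
structure FundData (n : ℕ) where
  Kp : ℕ → Fin n → ℝ
  Km : ℕ → Fin n → ℝ
  ap : ℕ → ℝ
  am : ℕ → ℝ
  bp : ℕ → ℝ
  bm : ℕ → ℝ

namespace PortfolioModel

variable {Ω : Type*} {n : ℕ} (M : PortfolioModel Ω n)

/-- Excess returns `P_t = e_t - s_t 1`. -/
def P (t : ℕ) (ω : Ω) : Fin n → ℝ := fun i => M.e t ω i - M.s t

/-- The accumulation factor `ρ_t = ∏_{j=t}^{T-1} s_j`; `ρ_T = 1`. -/
def ρ (t : ℕ) : ℝ := ∏ j ∈ Finset.Ico t M.T, M.s j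

/-- The discounted target `ρ_t⁻¹ W`. -/
noncomputable def target (t : ℕ) : ℝ := (M.ρ t)⁻¹ * M.W

/-- The piecewise linear state-dependent risk aversion `γ_t(x)`. -/
noncomputable def γ (t : ℕ) (x : ℝ) : ℝ :=
  if M.target t ≤ x then M.γp t * (x - M.target t) else -(M.γm t) * (x - M.target t)

/-- The information `σ(e_0, …, e_{t-1})` available at time `t`. -/
abbrev 𝓕 (t : ℕ) : MeasurableSpace Ω := ⨆ j : Fin t, MeasurableSpace.comap (M.e j) inferInstance

/-- The wealth `k` periods after time `t`, if the wealth at time `t` is `ξ` and the Markov policy `u`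
is followed: `X_{j+1} = s_j X_j + P_j' u_j(X_j)`. -/
def wealth (u : ℕ → ℝ → Fin n → ℝ) (t : ℕ) (ξ : Ω → ℝ) : ℕ → Ω → ℝ
  | 0 => ξ
  | k + 1 => fun ω => M.s (t + k) * wealth u t ξ k ω
      + M.P (t + k) ω ⬝ᵥ u (t + k) (wealth u t ξ k ω)

/-- The terminal wealth `X_T`, if the wealth at time `t ≤ T` is `ξ` and `u` is followed. -/
def terminalWealth (u : ℕ → ℝ → Fin n → ℝ) (t : ℕ) (ξ : Ω → ℝ) : Ω → ℝ :=
  M.wealth u t ξ (M.T - t)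

/-- `s_t + P_t' K`. -/
def R (t : ℕ) (K : Fin n → ℝ) (ω : Ω) : ℝ := M.s t + M.P t ω ⬝ᵥ K

/-- The piecewise linear feedback policy: `K_t^+ (x - ρ_t⁻¹ W)` if `x ≥ ρ_t⁻¹ W`, and
`K_t^- (x - ρ_t⁻¹ W)` if `x < ρ_t⁻¹ W`. -/
noncomputable def policy (D : FundData n) (t : ℕ) (x : ℝ) : Fin n → ℝ :=
  if M.target t ≤ x then (x - M.target t) • D.Kp t else (x - M.target t) • D.Km t

variable [MeasurableSpace Ω] (μ : Measure Ω)

/-- The objective `Var(X_T | X_t) - γ_t(X_t) E[X_T | X_t]`, where `X_t = ξ`. -/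
noncomputable def cost (u : ℕ → ℝ → Fin n → ℝ) (t : ℕ) (ξ : Ω → ℝ) (ω : Ω) : ℝ :=
  (Var[M.terminalWealth u t ξ; μ | MeasurableSpace.comap ξ inferInstance]) ω
    - M.γ t (ξ ω) * (μ[M.terminalWealth u t ξ | MeasurableSpace.comap ξ inferInstance]) ω

/-- `u` solves the nested mean-variance problem: at every time `t`, whatever the
current wealth `X_t = ξ` (a square integrable random variable known at time `t`), the
control `u_t` minimizes the time-`t` objective over all Markov controls `v` (with `v(X_t)` square
integrable), given that `u_{t+1}, …, u_{T-1}` are followed afterwards. -/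
def IsTimeConsistent (u : ℕ → ℝ → Fin n → ℝ) : Prop :=
  (∀ t < M.T, Measurable (u t)) ∧
  ∀ t < M.T, ∀ ξ : Ω → ℝ, Measurable[M.𝓕 t] ξ → MemLp ξ 2 μ →
    ∀ v : ℝ → Fin n → ℝ, Measurable v → MemLp (fun ω => v (ξ ω)) 2 μ →
      ∀ᵐ ω ∂μ, M.cost μ u t ξ ω ≤ M.cost μ (Function.update u t v) t ξ ω

/-- The mean vector `E[P_t]`. -/
noncomputable def meanP (t : ℕ) : Fin n → ℝ := fun i => ∫ ω, M.P t ω i ∂μ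

/-- The second moment matrix `E[P_t P_t']`. -/
noncomputable def secondP (t : ℕ) : Matrix (Fin n) (Fin n) ℝ :=
  Matrix.of fun i j => ∫ ω, M.P t ω i * M.P t ω j ∂μ

variable (D : FundData n)

/-- The function `F_t^+`. -/
noncomputable def Fp (t : ℕ) (K : Fin n → ℝ) : ℝ :=
  M.ρ (t + 1) ^ 2 *
      (K ⬝ᵥ (M.secondP μ t - Matrix.vecMulVec (M.meanP μ t) (M.meanP μ t)) *ᵥ K)
    + (∫ ω in {ω | 0 ≤ M.R t K ω},
        (2 * M.ρ (t + 1) * D.ap (t + 1) + D.bp (t + 1)) * M.R t K ω ^ 2 ∂μ)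
    + (∫ ω in {ω | M.R t K ω < 0},
        (2 * M.ρ (t + 1) * D.am (t + 1) + D.bm (t + 1)) * M.R t K ω ^ 2 ∂μ)
    - ((∫ ω in {ω | 0 ≤ M.R t K ω}, D.ap (t + 1) * M.R t K ω ∂μ)
        + ∫ ω in {ω | M.R t K ω < 0}, D.am (t + 1) * M.R t K ω ∂μ) ^ 2
    - 2 * M.ρ (t + 1) * (∫ ω in {ω | 0 ≤ M.R t K ω}, D.ap (t + 1) * M.R t K ω ∂μ)
        * (M.s t + M.meanP μ t ⬝ᵥ K)
    - 2 * M.ρ (t + 1) * (∫ ω in {ω | M.R t K ω < 0}, D.am (t + 1) * M.R t K ω ∂μ)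
        * (M.s t + M.meanP μ t ⬝ᵥ K)
    - M.γp t * ((∫ ω in {ω | 0 ≤ M.R t K ω}, D.ap (t + 1) * M.R t K ω ∂μ)
        + ∫ ω in {ω | M.R t K ω < 0}, D.am (t + 1) * M.R t K ω ∂μ)
    - M.ρ (t + 1) * M.γp t * (M.s t + M.meanP μ t ⬝ᵥ K)

/-- The function `F_t^-`. -/
noncomputable def Fm (t : ℕ) (K : Fin n → ℝ) : ℝ :=
  M.ρ (t + 1) ^ 2 *
      (K ⬝ᵥ (M.secondP μ t - Matrix.vecMulVec (M.meanP μ t) (M.meanP μ t)) *ᵥ K)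
    + (∫ ω in {ω | M.R t K ω ≤ 0},
        (2 * M.ρ (t + 1) * D.ap (t + 1) + D.bp (t + 1)) * M.R t K ω ^ 2 ∂μ)
    + (∫ ω in {ω | 0 < M.R t K ω},
        (2 * M.ρ (t + 1) * D.am (t + 1) + D.bm (t + 1)) * M.R t K ω ^ 2 ∂μ)
    - ((∫ ω in {ω | M.R t K ω ≤ 0}, D.ap (t + 1) * M.R t K ω ∂μ)
        + ∫ ω in {ω | 0 < M.R t K ω}, D.am (t + 1) * M.R t K ω ∂μ) ^ 2
    - 2 * M.ρ (t + 1) * (∫ ω in {ω | M.R t K ω ≤ 0}, D.ap (t + 1) * M.R t K ω ∂μ)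
        * (M.s t + M.meanP μ t ⬝ᵥ K)
    - 2 * M.ρ (t + 1) * (∫ ω in {ω | 0 < M.R t K ω}, D.am (t + 1) * M.R t K ω ∂μ)
        * (M.s t + M.meanP μ t ⬝ᵥ K)
    + M.γm t * ((∫ ω in {ω | M.R t K ω ≤ 0}, D.ap (t + 1) * M.R t K ω ∂μ)
        + ∫ ω in {ω | 0 < M.R t K ω}, D.am (t + 1) * M.R t K ω ∂μ)
    + M.ρ (t + 1) * M.γm t * (M.s t + M.meanP μ t ⬝ᵥ K)

/-- `D` is obtained by backward recursion: the terminal parameters vanish and, at every `t < T`,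
`K_t^±` is a global minimizer of `F_t^±` (which involves `a_{t+1}^±`, `b_{t+1}^±`) and
`a_t^±`, `b_t^±` are given by the recursion formulas. -/
structure IsBackwardSolution : Prop where
  ap_T : D.ap M.T = 0
  am_T : D.am M.T = 0
  bp_T : D.bp M.T = 0
  bm_T : D.bm M.T = 0
  Kp_min : ∀ t < M.T, ∀ K, M.Fp μ D t (D.Kp t) ≤ M.Fp μ D t K
  Km_min : ∀ t < M.T, ∀ K, M.Fm μ D t (D.Km t) ≤ M.Fm μ D t K
  ap_eq : ∀ t < M.T, D.ap t = M.ρ (t + 1) * (M.meanP μ t ⬝ᵥ D.Kp t)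
    + (∫ ω in {ω | 0 ≤ M.R t (D.Kp t) ω}, D.ap (t + 1) * M.R t (D.Kp t) ω ∂μ)
    + ∫ ω in {ω | M.R t (D.Kp t) ω < 0}, D.am (t + 1) * M.R t (D.Kp t) ω ∂μ
  am_eq : ∀ t < M.T, D.am t = M.ρ (t + 1) * (M.meanP μ t ⬝ᵥ D.Km t)
    + (∫ ω in {ω | M.R t (D.Km t) ω ≤ 0}, D.ap (t + 1) * M.R t (D.Km t) ω ∂μ)
    + ∫ ω in {ω | 0 < M.R t (D.Km t) ω}, D.am (t + 1) * M.R t (D.Km t) ω ∂μ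
  bp_eq : ∀ t < M.T, D.bp t = M.ρ (t + 1) ^ 2 * (D.Kp t ⬝ᵥ M.secondP μ t *ᵥ D.Kp t)
    + 2 * M.ρ (t + 1) * (∫ ω in {ω | 0 ≤ M.R t (D.Kp t) ω},
        D.ap (t + 1) * M.R t (D.Kp t) ω * (M.P t ω ⬝ᵥ D.Kp t) ∂μ)
    + 2 * M.ρ (t + 1) * (∫ ω in {ω | M.R t (D.Kp t) ω < 0},
        D.am (t + 1) * M.R t (D.Kp t) ω * (M.P t ω ⬝ᵥ D.Kp t) ∂μ)
    + (∫ ω in {ω | 0 ≤ M.R t (D.Kp t) ω}, D.bp (t + 1) * M.R t (D.Kp t) ω ^ 2 ∂μ)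
    + ∫ ω in {ω | M.R t (D.Kp t) ω < 0}, D.bm (t + 1) * M.R t (D.Kp t) ω ^ 2 ∂μ
  bm_eq : ∀ t < M.T, D.bm t = M.ρ (t + 1) ^ 2 * (D.Km t ⬝ᵥ M.secondP μ t *ᵥ D.Km t)
    + 2 * M.ρ (t + 1) * (∫ ω in {ω | M.R t (D.Km t) ω ≤ 0},
        D.ap (t + 1) * M.R t (D.Km t) ω * (M.P t ω ⬝ᵥ D.Km t) ∂μ)
    + 2 * M.ρ (t + 1) * (∫ ω in {ω | 0 < M.R t (D.Km t) ω},
        D.am (t + 1) * M.R t (D.Km t) ω * (M.P t ω ⬝ᵥ D.Km t) ∂μ)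
    + (∫ ω in {ω | M.R t (D.Km t) ω ≤ 0}, D.bp (t + 1) * M.R t (D.Km t) ω ^ 2 ∂μ)
    + ∫ ω in {ω | 0 < M.R t (D.Km t) ω}, D.bm (t + 1) * M.R t (D.Km t) ω ^ 2 ∂μ

end PortfolioModel

/-! Everything is expressed through the surplus `Y_t = X_t - ρ_t⁻¹ W`. Since the target grows at the
riskless rate, `Y_{t+1} = s_t Y_t + P_t' u_t`, with no inhomogeneous term. The claim propagated
backwards is that, under the piecewise linear policy, the first and second moments of the terminal
surplus `X_T - W` given `𝓕_t` are a piecewise linear and a piecewise quadratic function of `Y_t`.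
The slopes are `ρ_t + a_t^±` and the curvatures `ρ_t² + 2 ρ_t a_t^± + b_t^±` (`surplusCoef`,
`hasSurplusMoments`).

By independence of `P_t` from the past, the cost of a control `w` at surplus `y` is, up to a term
free of `w`, a one-period `objective`. This is homogeneous of degree two under joint nonnegative
scaling of `y`, `w` and the risk aversion, which is itself linear on each side of the target. Hence
only `y = 1` and `y = -1` matter, and there the objective is exactly `F_t^+` and `F_t^-`
(`Fp_eq_objective`, `Fm_eq_objective`). Minimizers of `F_t^±` thus give optimal linear feedback, and
the formulas for `a_t^±`, `b_t^±` record the resulting moments (`isBackwardSolution_iff`).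

Existence and strictness rest on `KinkCoef.Valid`, which includes `slope² ≤ curvature`, equivalent
to `a² ≤ b`. It persists backwards because a second moment dominates the square of the mean.
Absolutely continuous returns have no atoms in any nonzero direction, so the variance part is
strictly positive at `y = 0`, `w ≠ 0`; compactness of the sphere and homogeneity turn this into
quadratic growth, hence coercivity. The same strictness forces zero investment at the target, where
the risk aversion vanishes. Uniqueness follows by backward induction, testing with deterministic
wealth and constant controls. -/

/-! ### Conditional expectations of functions of independent variables. -/

/-- Conditioning a function of the independent variables `X` and `Y` on `X` amounts to integrating
out `Y`. -/
theorem condExp_comap_of_indepFun {Ω α β E : Type*} [MeasurableSpace Ω] {μ : Measure Ω}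
    [IsProbabilityMeasure μ] [mα : MeasurableSpace α] [MeasurableSpace β] [MeasurableSpace E]
    [StandardBorelSpace E]
    {X : Ω → α} {Y : Ω → E} {f : α → β} (hX : Measurable X) (hY : Measurable Y) (hf : Measurable f)
    (hind : X ⟂ᵢ[μ] Y) {h : β × E → ℝ} (hh : Measurable h)
    (hint : Integrable (fun ω => h (f (X ω), Y ω)) μ) :
    μ[fun ω => h (f (X ω), Y ω) | mα.comap X] =ᵐ[μ] fun ω => ∫ ω', h (f (X ω), Y ω') ∂μ := by
  have : Nonempty E := by
    obtain ⟨ω⟩ : Nonempty Ω := μ.nonempty_of_neZero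
    exact ⟨Y ω⟩
  have : IsProbabilityMeasure (μ.map Y) := Measure.isProbabilityMeasure_map hY.aemeasurable
  -- Independence makes the conditional law of `Y` given `X` the constant kernel at the law of `Y`.
  have hcd : condDistrib Y X μ =ᵐ[μ.map X] Kernel.const α (μ.map Y) := by
    refine condDistrib_ae_eq_of_measure_eq_compProd_of_measurable hX hY ?_
    rw [Measure.compProd_const]
    exact (indepFun_iff_map_prod_eq_prod_map_map hX.aemeasurable hY.aemeasurable).1 hind
  have hpair : Measurable fun p : α × E => h (f p.1, p.2) :=
    hh.comp ((hf.comp measurable_fst).prodMk measurable_snd)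
  filter_upwards [condExp_prod_ae_eq_integral_condDistrib hX hY.aemeasurable
    hpair.stronglyMeasurable hint, ae_of_ae_map hX.aemeasurable hcd] with ω h1 h2
  rw [h1, h2, Kernel.const_apply, integral_map hY.aemeasurable]
  exact (hh.comp measurable_prodMk_left).aestronglyMeasurable

/-- Freezing lemma: if `X` is `m`-measurable and `Y` is independent of `m`, then conditioning
`h (X, Y)` on `m` amounts to integrating out `Y` with `X` frozen. -/
theorem condExp_freezing {Ω β E : Type*} {m m₀ : MeasurableSpace Ω} {μ : Measure Ω}
    [IsProbabilityMeasure μ] [MeasurableSpace β] [MeasurableSpace E] [StandardBorelSpace E]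
    (hm : m ≤ m₀) {X : Ω → β} {Y : Ω → E} (hX : Measurable[m] X) (hY : Measurable Y)
    (hind : Indep m (MeasurableSpace.comap Y inferInstance) μ) {h : β × E → ℝ}
    (hh : Measurable h) (hint : Integrable (fun ω => h (X ω, Y ω)) μ) :
    μ[fun ω => h (X ω, Y ω) | m] =ᵐ[μ] fun ω => ∫ ω', h (X ω, Y ω') ∂μ := by
  -- A general `m` is the σ-algebra generated by the identity map from `(Ω, m₀)` to `(Ω, m)`, which
  -- reduces to conditioning on a random variable.
  have hid : @Measurable Ω Ω m₀ m id := fun s hs => hm s hs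
  have hif : @IndepFun Ω Ω E m₀ m _ id Y μ := by
    refine (@IndepFun_iff_Indep Ω Ω E m₀ m _ id Y μ).2 ?_
    rw [@MeasurableSpace.comap_id Ω m]
    exact hind
  have key := @condExp_comap_of_indepFun Ω Ω β E m₀ μ _ m _ _ _ id Y X hid hY hX hif h hh hint
  exact (MeasurableSpace.comap_id (m := m)) ▸ key

/-! ### Piecewise linear and quadratic functions with a kink at the origin. -/

/-- The slopes and curvatures of a pair of piecewise functions with a kink at the origin. -/
structure KinkCoef where
  slopePos : ℝ
  slopeNeg : ℝ
  curvPos : ℝ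
  curvNeg : ℝ

namespace KinkCoef

variable (κ : KinkCoef)

/-- The piecewise linear function with the given slopes. -/
noncomputable def lin (y : ℝ) : ℝ := κ.slopePos * max y 0 + κ.slopeNeg * min y 0

/-- The piecewise quadratic function with the given curvatures. -/
noncomputable def quad (y : ℝ) : ℝ := κ.curvPos * max y 0 ^ 2 + κ.curvNeg * min y 0 ^ 2

/-- The quadratic function is positive away from the origin and dominates the square of the
linear one. -/
structure Valid : Prop where
  curvPos_pos : 0 < κ.curvPos
  curvNeg_pos : 0 < κ.curvNeg
  sq_slopePos_le : κ.slopePos ^ 2 ≤ κ.curvPos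
  sq_slopeNeg_le : κ.slopeNeg ^ 2 ≤ κ.curvNeg

@[fun_prop]
theorem continuous_lin : Continuous κ.lin := by unfold lin; fun_prop

@[fun_prop]
theorem continuous_quad : Continuous κ.quad := by unfold quad; fun_prop

theorem lin_of_nonneg {y : ℝ} (hy : 0 ≤ y) : κ.lin y = κ.slopePos * y := by
  simp [lin, hy]

theorem lin_of_nonpos {y : ℝ} (hy : y ≤ 0) : κ.lin y = κ.slopeNeg * y := by
  simp [lin, hy]

theorem quad_of_nonneg {y : ℝ} (hy : 0 ≤ y) : κ.quad y = κ.curvPos * y ^ 2 := by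
  simp [quad, hy]

theorem quad_of_nonpos {y : ℝ} (hy : y ≤ 0) : κ.quad y = κ.curvNeg * y ^ 2 := by
  simp [quad, hy]

theorem lin_mul {r : ℝ} (hr : 0 ≤ r) (y : ℝ) : κ.lin (r * y) = r * κ.lin y := by
  rcases le_total 0 y with hy | hy
  · rw [lin_of_nonneg _ hy, lin_of_nonneg _ (mul_nonneg hr hy)]; ring
  · rw [lin_of_nonpos _ hy, lin_of_nonpos _ (mul_nonpos_of_nonneg_of_nonpos hr hy)]; ring

theorem quad_mul {r : ℝ} (hr : 0 ≤ r) (y : ℝ) : κ.quad (r * y) = r ^ 2 * κ.quad y := by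
  rcases le_total 0 y with hy | hy
  · rw [quad_of_nonneg _ hy, quad_of_nonneg _ (mul_nonneg hr hy)]; ring
  · rw [quad_of_nonpos _ hy, quad_of_nonpos _ (mul_nonpos_of_nonneg_of_nonpos hr hy)]; ring

theorem abs_lin_le (y : ℝ) : |κ.lin y| ≤ (|κ.slopePos| + |κ.slopeNeg|) * |y| := by
  rcases le_total 0 y with hy | hy
  · rw [lin_of_nonneg _ hy, abs_mul]
    gcongr
    linarith [abs_nonneg κ.slopeNeg]
  · rw [lin_of_nonpos _ hy, abs_mul]
    gcongr
    linarith [abs_nonneg κ.slopePos]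

theorem abs_quad_le (y : ℝ) : |κ.quad y| ≤ (|κ.curvPos| + |κ.curvNeg|) * y ^ 2 := by
  rcases le_total 0 y with hy | hy
  · rw [quad_of_nonneg _ hy, abs_mul, abs_of_nonneg (sq_nonneg y)]
    gcongr
    linarith [abs_nonneg κ.curvNeg]
  · rw [quad_of_nonpos _ hy, abs_mul, abs_of_nonneg (sq_nonneg y)]
    gcongr
    linarith [abs_nonneg κ.curvPos]

variable {κ}

theorem Valid.lin_sq_le_quad (hκ : κ.Valid) (y : ℝ) : κ.lin y ^ 2 ≤ κ.quad y := by
  rcases le_total 0 y with hy | hy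
  · rw [lin_of_nonneg _ hy, quad_of_nonneg _ hy, mul_pow]
    gcongr
    exact hκ.sq_slopePos_le
  · rw [lin_of_nonpos _ hy, quad_of_nonpos _ hy, mul_pow]
    gcongr
    exact hκ.sq_slopeNeg_le

theorem Valid.quad_pos (hκ : κ.Valid) {y : ℝ} (hy : y ≠ 0) : 0 < κ.quad y := by
  have h2 : 0 < y ^ 2 := by positivity
  rcases le_total 0 y with hy | hy
  · rw [quad_of_nonneg _ hy]; exact mul_pos hκ.curvPos_pos h2
  · rw [quad_of_nonpos _ hy]; exact mul_pos hκ.curvNeg_pos h2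

theorem Valid.quad_nonneg (hκ : κ.Valid) (y : ℝ) : 0 ≤ κ.quad y :=
  (sq_nonneg _).trans (hκ.lin_sq_le_quad y)

/-- A nonzero point where the linear function takes the value `k` and where its square agrees
with the quadratic function is one of two points. -/
theorem Valid.eq_div_of_lin_eq (hκ : κ.Valid) {y k : ℝ} (hk : κ.lin y = k)
    (hq : κ.quad y = κ.lin y ^ 2) :
    y = 0 ∨ y = k / κ.slopePos ∨ y = k / κ.slopeNeg := by
  by_cases hy0 : y = 0
  · exact .inl hy0
  have hne : κ.lin y ≠ 0 := fun h => by
    have := hκ.quad_pos hy0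
    rw [hq, h] at this
    simp at this
  rcases le_total 0 y with hy | hy
  · rw [lin_of_nonneg _ hy] at hk hne
    exact .inr (.inl ((eq_div_iff (left_ne_zero_of_mul hne)).2 (by linarith)))
  · rw [lin_of_nonpos _ hy] at hk hne
    exact .inr (.inr ((eq_div_iff (left_ne_zero_of_mul hne)).2 (by linarith)))

section Integrability

variable {Ω : Type*} [MeasurableSpace Ω] {μ : Measure Ω} {Z : Ω → ℝ}

theorem memLp_lin (κ : KinkCoef) (hZ : MemLp Z 2 μ) : MemLp (fun ω => κ.lin (Z ω)) 2 μ :=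
  hZ.of_le_mul (κ.continuous_lin.comp_aestronglyMeasurable hZ.1)
    (.of_forall fun ω => by simpa using κ.abs_lin_le (Z ω))

theorem integrable_quad (κ : KinkCoef) (hZ : MemLp Z 2 μ) :
    Integrable (fun ω => κ.quad (Z ω)) μ :=
  (hZ.integrable_sq.const_mul (|κ.curvPos| + |κ.curvNeg|)).mono'
    (κ.continuous_quad.comp_aestronglyMeasurable hZ.1)
    (.of_forall fun ω => by simpa using κ.abs_quad_le (Z ω))

end Integrability

end KinkCoef

/-! ### Dot products and hyperplanes. -/

theorem abs_dotProduct_le_card_mul {n : ℕ} (p w : Fin n → ℝ) : |p ⬝ᵥ w| ≤ n * ‖p‖ * ‖w‖ := by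
  calc |p ⬝ᵥ w| ≤ ∑ i, |p i * w i| := Finset.abs_sum_le_sum_abs _ _
    _ ≤ ∑ _i : Fin n, ‖p‖ * ‖w‖ := by
        refine Finset.sum_le_sum fun i _ => ?_
        rw [abs_mul]
        exact mul_le_mul (norm_le_pi_norm p i) (norm_le_pi_norm w i) (abs_nonneg _) (norm_nonneg _)
    _ = n * ‖p‖ * ‖w‖ := by simp [mul_assoc]

/-- A hyperplane is a null set. -/
theorem volume_dotProduct_eq {n : ℕ} {w : Fin n → ℝ} (hw : w ≠ 0) (c : ℝ) :
    volume {x : Fin n → ℝ | x ⬝ᵥ w = c} = 0 := by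
  let f : (Fin n → ℝ) →ₗ[ℝ] ℝ := (dotProductBilin ℝ ℝ).flip w
  have hf (x) : f x = x ⬝ᵥ w := rfl
  let S : AffineSubspace ℝ (Fin n → ℝ) := (AffineSubspace.mk' c ⊥).comap f.toAffineMap
  have hS : (S : Set (Fin n → ℝ)) = {x | x ⬝ᵥ w = c} := by
    ext x
    simp [S, hf, sub_eq_zero]
  rw [← hS]
  -- A proper affine subspace is null. If it were the whole space, `x = 0` would give `c = 0` and `x
  -- = w` would give `w ⬝ᵥ w = 0`.
  refine Measure.addHaar_affineSubspace _ _ fun htop => hw ?_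
  have hmem (x : Fin n → ℝ) : x ⬝ᵥ w = c := by
    have : x ∈ (S : Set (Fin n → ℝ)) := by rw [htop]; trivial
    rwa [hS] at this
  have h0 := hmem 0
  rw [zero_dotProduct] at h0
  have := hmem w
  rwa [← h0, dotProduct_self_eq_zero] at this

/-! ### The one-period mean-variance problem. -/

section Surplus

variable {Ω : Type*} {n : ℕ}

/-- The surplus over the target after one period: the riskless return on the surplus `y` plus the
gain of the investment `w`. -/
def nextSurplus (s : ℝ) (P : Ω → Fin n → ℝ) (y : ℝ) (w : Fin n → ℝ) (ω : Ω) : ℝ :=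
  s * y + P ω ⬝ᵥ w

theorem nextSurplus_smul (s : ℝ) (P : Ω → Fin n → ℝ) (r y : ℝ) (w : Fin n → ℝ) (ω : Ω) :
    nextSurplus s P (r * y) (r • w) ω = r * nextSurplus s P y w ω := by
  simp only [nextSurplus, dotProduct_smul, smul_eq_mul]; ring

theorem continuous_nextSurplus (s : ℝ) (P : Ω → Fin n → ℝ) (ω : Ω) :
    Continuous fun p : ℝ × (Fin n → ℝ) => nextSurplus s P p.1 p.2 ω := by
  unfold nextSurplus dotProduct; fun_prop

theorem abs_nextSurplus_le (s : ℝ) (P : Ω → Fin n → ℝ) (y : ℝ) (w : Fin n → ℝ) (ω : Ω) :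
    |nextSurplus s P y w ω| ≤ (|s| + n * ‖P ω‖) * ‖(y, w)‖ := by
  have h1 : |y| ≤ ‖(y, w)‖ := norm_fst_le (y, w)
  have h2 : ‖w‖ ≤ ‖(y, w)‖ := norm_snd_le (y, w)
  calc |nextSurplus s P y w ω| ≤ |s * y| + |P ω ⬝ᵥ w| := abs_add_le _ _
    _ ≤ |s| * ‖(y, w)‖ + n * ‖P ω‖ * ‖(y, w)‖ := by
        rw [abs_mul]
        gcongr
        exact (abs_dotProduct_le_card_mul _ _).trans (by gcongr)
    _ = _ := by ring

variable [MeasurableSpace Ω] {μ : Measure Ω} {P : Ω → Fin n → ℝ}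

theorem memLp_dotProduct (hP : MemLp P 2 μ) (w : Fin n → ℝ) :
    MemLp (fun ω => P ω ⬝ᵥ w) 2 μ := by
  exact memLp_finsetSum (f := fun i ω => P ω i * w i) _ fun i _ => (hP.eval i).mul_const (w i)

theorem memLp_nextSurplus [IsFiniteMeasure μ] (s : ℝ) (hP : MemLp P 2 μ) (y : ℝ)
    (w : Fin n → ℝ) : MemLp (nextSurplus s P y w) 2 μ :=
  (memLp_const (s * y)).add (memLp_dotProduct hP w)

/-- Every nondegenerate linear combination of the components of `P` is free of atoms. -/
def AtomlessCombinations (μ : Measure Ω) (P : Ω → Fin n → ℝ) : Prop :=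
  ∀ w : Fin n → ℝ, w ≠ 0 → ∀ c : ℝ, ∀ᵐ ω ∂μ, P ω ⬝ᵥ w ≠ c

namespace KinkCoef

/-- The expectation of the piecewise linear function of the next surplus. -/
noncomputable def meanLin (κ : KinkCoef) (μ : Measure Ω) (s : ℝ) (P : Ω → Fin n → ℝ)
    (y : ℝ) (w : Fin n → ℝ) : ℝ := ∫ ω, κ.lin (nextSurplus s P y w ω) ∂μ

/-- The expectation of the piecewise quadratic function of the next surplus. -/
noncomputable def meanQuad (κ : KinkCoef) (μ : Measure Ω) (s : ℝ) (P : Ω → Fin n → ℝ)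
    (y : ℝ) (w : Fin n → ℝ) : ℝ := ∫ ω, κ.quad (nextSurplus s P y w ω) ∂μ

/-- The one-period mean-variance objective with risk aversion `g`. -/
noncomputable def objective (κ : KinkCoef) (μ : Measure Ω) (s : ℝ) (P : Ω → Fin n → ℝ)
    (g y : ℝ) (w : Fin n → ℝ) : ℝ :=
  κ.meanQuad μ s P y w - κ.meanLin μ s P y w ^ 2 - g * κ.meanLin μ s P y w

variable (κ : KinkCoef) (μ) {s : ℝ} (P)

theorem meanLin_smul {r : ℝ} (hr : 0 ≤ r) (y : ℝ) (w : Fin n → ℝ) :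
    κ.meanLin μ s P (r * y) (r • w) = r * κ.meanLin μ s P y w := by
  simp only [meanLin, nextSurplus_smul, κ.lin_mul hr, integral_const_mul]

theorem meanQuad_smul {r : ℝ} (hr : 0 ≤ r) (y : ℝ) (w : Fin n → ℝ) :
    κ.meanQuad μ s P (r * y) (r • w) = r ^ 2 * κ.meanQuad μ s P y w := by
  simp only [meanQuad, nextSurplus_smul, κ.quad_mul hr, integral_const_mul]

/-- The scaling factor must be nonnegative, because a negative one exchanges the two sides of the
kink; this is why the cases `y = 1` and `y = -1` stay separate. -/
theorem objective_smul {r : ℝ} (hr : 0 ≤ r) (g y : ℝ) (w : Fin n → ℝ) :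
    κ.objective μ s P (r * g) (r * y) (r • w) = r ^ 2 * κ.objective μ s P g y w := by
  simp only [objective, meanLin_smul _ _ _ hr, meanQuad_smul _ _ _ hr]; ring

variable {μ P} {κ}

theorem continuous_meanLin [IsFiniteMeasure μ] (hP : MemLp P 2 μ) :
    Continuous fun p : ℝ × (Fin n → ℝ) => κ.meanLin μ s P p.1 p.2 := by
  refine continuous_iff_continuousAt.2 fun p₀ => ?_
  refine continuousAt_of_dominated (bound := fun ω => (|κ.slopePos| + |κ.slopeNeg|) *
    ((|s| + n * ‖P ω‖) * (‖p₀‖ + 1))) ?_ ?_ ?_ ?_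
  · exact .of_forall fun p => (memLp_lin κ (memLp_nextSurplus s hP p.1 p.2)).1
  -- Domination is needed only near `p₀`, where the norm is below `‖p₀‖ + 1`.
  · filter_upwards [(continuous_norm.tendsto p₀).eventually_lt_const (lt_add_one ‖p₀‖)] with p hp
    refine .of_forall fun ω => (κ.abs_lin_le _).trans ?_
    gcongr
    exact (abs_nextSurplus_le s P p.1 p.2 ω).trans (by gcongr)
  · exact ((((integrable_const _).add ((hP.norm.integrable one_le_two).const_mul _)).mul_const
      _).const_mul _)
  · exact .of_forall fun ω => (κ.continuous_lin.comp (continuous_nextSurplus s P ω)).continuousAt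

theorem continuous_meanQuad [IsFiniteMeasure μ] (hP : MemLp P 2 μ) :
    Continuous fun p : ℝ × (Fin n → ℝ) => κ.meanQuad μ s P p.1 p.2 := by
  refine continuous_iff_continuousAt.2 fun p₀ => ?_
  refine continuousAt_of_dominated (bound := fun ω => (|κ.curvPos| + |κ.curvNeg|) *
    ((|s| + n * ‖P ω‖) * (‖p₀‖ + 1)) ^ 2) ?_ ?_ ?_ ?_
  · exact .of_forall fun p => (integrable_quad κ (memLp_nextSurplus s hP p.1 p.2)).1
  · filter_upwards [(continuous_norm.tendsto p₀).eventually_lt_const (lt_add_one ‖p₀‖)] with p hp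
    refine .of_forall fun ω => (κ.abs_quad_le _).trans ?_
    rw [← sq_abs (nextSurplus _ _ _ _ _)]
    gcongr
    exact (abs_nextSurplus_le s P p.1 p.2 ω).trans (by gcongr)
  · exact (MemLp.integrable_sq (((memLp_const |s|).add (hP.norm.const_mul (n : ℝ))).mul_const
      (‖p₀‖ + 1))).const_mul _
  · exact .of_forall fun ω => (κ.continuous_quad.comp (continuous_nextSurplus s P ω)).continuousAt

variable [IsProbabilityMeasure μ]

/-- This is the law of total variance: `quad - lin²` plays the conditional variance and `lin` the
conditional mean. -/
theorem meanQuad_sub_sq_eq (hP : MemLp P 2 μ) (y : ℝ) (w : Fin n → ℝ) :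
    κ.meanQuad μ s P y w - κ.meanLin μ s P y w ^ 2 =
      (∫ ω, (κ.quad (nextSurplus s P y w ω) - κ.lin (nextSurplus s P y w ω) ^ 2) ∂μ) +
        Var[fun ω => κ.lin (nextSurplus s P y w ω); μ] := by
  have hZ := memLp_nextSurplus s hP y w
  rw [variance_eq_sub (memLp_lin κ hZ), integral_sub (integrable_quad κ hZ)
    (memLp_lin κ hZ).integrable_sq]
  simp only [meanQuad, meanLin, Pi.pow_apply]
  ring

theorem Valid.sq_meanLin_le (hκ : κ.Valid) (hP : MemLp P 2 μ) (y : ℝ) (w : Fin n → ℝ) :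
    κ.meanLin μ s P y w ^ 2 ≤ κ.meanQuad μ s P y w := by
  rw [← sub_nonneg, meanQuad_sub_sq_eq hP]
  exact add_nonneg (integral_nonneg fun ω => sub_nonneg.2 (hκ.lin_sq_le_quad _))
    (variance_nonneg _ _)

/-- Equality would kill both nonnegative terms of the total variance. Then `lin` is almost surely
constant and `quad = lin²`, so `P ⬝ᵥ w` takes at most three values, which atomlessness forbids. -/
theorem Valid.sq_meanLin_lt (hκ : κ.Valid) (hP : MemLp P 2 μ) (hPa : AtomlessCombinations μ P)
    {w : Fin n → ℝ} (hw : w ≠ 0) :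
    κ.meanLin μ s P 0 w ^ 2 < κ.meanQuad μ s P 0 w := by
  refine lt_of_le_of_ne (hκ.sq_meanLin_le hP 0 w) fun heq => ?_
  have hZ := memLp_nextSurplus s hP 0 w
  have hpos : ∀ ω, 0 ≤ κ.quad (nextSurplus s P 0 w ω) - κ.lin (nextSurplus s P 0 w ω) ^ 2 :=
    fun ω => sub_nonneg.2 (hκ.lin_sq_le_quad _)
  have h := meanQuad_sub_sq_eq (κ := κ) (s := s) hP 0 w
  rw [heq, sub_self] at h
  have hv := variance_nonneg (fun ω => κ.lin (nextSurplus s P 0 w ω)) μ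
  have hi : 0 ≤ ∫ ω, (κ.quad (nextSurplus s P 0 w ω) - κ.lin (nextSurplus s P 0 w ω) ^ 2) ∂μ :=
    integral_nonneg hpos
  have hv0 : Var[fun ω => κ.lin (nextSurplus s P 0 w ω); μ] = 0 := by linarith
  have hi0 : (∫ ω, (κ.quad (nextSurplus s P 0 w ω) - κ.lin (nextSurplus s P 0 w ω) ^ 2) ∂μ) = 0 := by
    linarith
  rw [integral_eq_zero_iff_of_nonneg hpos
    ((integrable_quad κ hZ).sub (memLp_lin κ hZ).integrable_sq)] at hi0
  have hv1 := (evariance_eq_zero_iff (memLp_lin κ hZ).1.aemeasurable).1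
    (by rw [← (memLp_lin κ hZ).ofReal_variance_eq, hv0, ENNReal.ofReal_zero])
  set k := ∫ ω, κ.lin (nextSurplus s P 0 w ω) ∂μ with hk
  have hfalse : ∀ᵐ ω ∂μ, False := by
    filter_upwards [hi0, hv1, hPa w hw 0, hPa w hw (k / κ.slopePos), hPa w hw (k / κ.slopeNeg)]
      with ω h1 h2 h3 h4 h5
    have hval : nextSurplus s P 0 w ω = P ω ⬝ᵥ w := by simp [nextSurplus]
    rw [hval] at h1 h2
    rcases hκ.eq_div_of_lin_eq h2 (sub_eq_zero.1 h1) with h | h | h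
    exacts [h3 h, h4 h, h5 h]
  obtain ⟨ω, hω⟩ := hfalse.exists
  exact hω

theorem Valid.meanQuad_pos (hκ : κ.Valid) (hs : s ≠ 0) (hP : MemLp P 2 μ)
    (hPa : AtomlessCombinations μ P) {y : ℝ} (hy : y ≠ 0) (w : Fin n → ℝ) :
    0 < κ.meanQuad μ s P y w := by
  have hne : ∀ᵐ ω ∂μ, nextSurplus s P y w ω ≠ 0 := by
    -- Without investment the next surplus is the constant `s * y ≠ 0`; otherwise it avoids `0` by
    -- atomlessness.
    by_cases hw : w = 0
    · refine .of_forall fun ω => ?_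
      simpa [nextSurplus, hw] using ⟨hs, hy⟩
    · filter_upwards [hPa w hw (-(s * y))] with ω hω h
      exact hω (by simp only [nextSurplus] at h; linarith)
  have hpos : ∀ ω, 0 ≤ κ.quad (nextSurplus s P y w ω) := fun ω => hκ.quad_nonneg _
  refine lt_of_le_of_ne (integral_nonneg hpos) fun h => ?_
  rw [meanQuad, eq_comm, integral_eq_zero_iff_of_nonneg hpos
    (integrable_quad κ (memLp_nextSurplus s hP y w))] at h
  obtain ⟨ω, h1, h2⟩ := (h.and hne).exists
  exact (hκ.quad_pos h2).ne' h1

/-- The variance part of the objective grows quadratically in the investment. -/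
theorem Valid.exists_le_meanQuad_sub_sq (hκ : κ.Valid) (hP : MemLp P 2 μ)
    (hPa : AtomlessCombinations μ P) :
    ∃ m > 0, ∀ y : ℝ, ∀ w : Fin n → ℝ,
      m * ‖w‖ ^ 2 - y ^ 2 ≤ κ.meanQuad μ s P y w - κ.meanLin μ s P y w ^ 2 := by
  -- The added `y²` makes `V` positive off the whole origin of `(y, w)`-space, including where the
  -- variance part may vanish for `y ≠ 0`. As `V` is homogeneous of degree two, `m` is its minimum
  -- on the unit sphere.
  let V : ℝ × (Fin n → ℝ) → ℝ := fun p =>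
    κ.meanQuad μ s P p.1 p.2 - κ.meanLin μ s P p.1 p.2 ^ 2 + p.1 ^ 2
  have hcont : Continuous V :=
    ((continuous_meanQuad hP).sub ((continuous_meanLin hP).pow 2)).add (continuous_fst.pow 2)
  have hpos : ∀ p ≠ 0, 0 < V p := by
    rintro ⟨y, w⟩ hp
    by_cases hy : y = 0
    · subst hy
      have hw : w ≠ 0 := fun h => hp (by rw [h]; rfl)
      simpa [V] using hκ.sq_meanLin_lt (s := s) hP hPa hw
    · exact add_pos_of_nonneg_of_pos (sub_nonneg.2 (hκ.sq_meanLin_le hP y w)) (by positivity)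
  obtain ⟨p₁, hp₁, hmin⟩ := (isCompact_sphere (0 : ℝ × (Fin n → ℝ)) 1).exists_isMinOn
    (NormedSpace.sphere_nonempty.2 zero_le_one) hcont.continuousOn
  have hp₁0 : p₁ ≠ 0 := by
    rintro rfl
    simp at hp₁
  refine ⟨V p₁, hpos p₁ hp₁0, fun y w => ?_⟩
  by_cases hp : ((y, w) : ℝ × (Fin n → ℝ)) = 0
  · obtain ⟨rfl, rfl⟩ := Prod.mk_inj.1 hp
    simpa using hκ.sq_meanLin_le (s := s) hP 0 0
  set r := ‖((y, w) : ℝ × (Fin n → ℝ))‖ with hr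
  have hr0 : 0 < r := norm_pos_iff.2 hp
  have hsph : ((r⁻¹ * y, r⁻¹ • w) : ℝ × (Fin n → ℝ)) ∈ Metric.sphere (0 : ℝ × (Fin n → ℝ)) 1 := by
    have : ((r⁻¹ * y, r⁻¹ • w) : ℝ × (Fin n → ℝ)) = r⁻¹ • (y, w) := rfl
    rw [this, mem_sphere_zero_iff_norm, norm_smul, ← hr, norm_inv, Real.norm_of_nonneg hr0.le,
      inv_mul_cancel₀ hr0.ne']
  have hle : V p₁ ≤ V (r⁻¹ * y, r⁻¹ • w) := hmin hsph
  have hV : V (r⁻¹ * y, r⁻¹ • w) = (r⁻¹) ^ 2 * V (y, w) := by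
    simp only [V, meanQuad_smul _ _ _ (inv_nonneg.2 hr0.le),
      meanLin_smul _ _ _ (inv_nonneg.2 hr0.le)]
    ring
  rw [hV, inv_pow, ← div_eq_inv_mul, le_div_iff₀ (by positivity)] at hle
  have hwr : ‖w‖ ≤ r := norm_snd_le (y, w)
  have : V p₁ * ‖w‖ ^ 2 ≤ V p₁ * r ^ 2 := by
    have := (hpos p₁ hp₁0).le
    gcongr
  have hVdef : V (y, w) = κ.meanQuad μ s P y w - κ.meanLin μ s P y w ^ 2 + y ^ 2 := rfl
  linarith

theorem exists_abs_meanLin_le (κ : KinkCoef) (s : ℝ) (hP : MemLp P 2 μ) :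
    ∃ C, ∀ y : ℝ, ∀ w : Fin n → ℝ, |κ.meanLin μ s P y w| ≤ C * ‖(y, w)‖ := by
  refine ⟨∫ ω, (|κ.slopePos| + |κ.slopeNeg|) * (|s| + n * ‖P ω‖) ∂μ, fun y w => ?_⟩
  rw [← integral_mul_const]
  have hint : Integrable (fun ω => (|κ.slopePos| + |κ.slopeNeg|) * (|s| + n * ‖P ω‖) * ‖(y, w)‖) μ :=
    (((integrable_const |s|).add ((hP.norm.integrable one_le_two).const_mul (n : ℝ))).const_mul
      _).mul_const _
  rw [← Real.norm_eq_abs, meanLin]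
  refine norm_integral_le_of_norm_le hint (.of_forall fun ω => (κ.abs_lin_le _).trans ?_)
  rw [mul_assoc]
  gcongr
  exact abs_nextSurplus_le s P y w ω

/-- The variance part grows quadratically in `w`, the mean term at most linearly; the continuous
objective is therefore coercive. -/
theorem Valid.exists_forall_objective_le (hκ : κ.Valid) (hP : MemLp P 2 μ)
    (hPa : AtomlessCombinations μ P) (g y : ℝ) :
    ∃ w, ∀ w', κ.objective μ s P g y w ≤ κ.objective μ s P g y w' := by
  have hcont : Continuous (κ.objective μ s P g y) := by
    have h1 := (continuous_meanQuad (κ := κ) (s := s) hP).comp (Continuous.prodMk_right y)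
    have h2 := (continuous_meanLin (κ := κ) (s := s) hP).comp (Continuous.prodMk_right y)
    exact (h1.sub (h2.pow 2)).sub (h2.const_mul g)
  obtain ⟨m, hm, hV⟩ := hκ.exists_le_meanQuad_sub_sq (s := s) hP hPa
  obtain ⟨C, hC⟩ := exists_abs_meanLin_le κ s hP
  refine hcont.exists_forall_le ?_
  have hlow : ∀ w, ‖w‖ * (m * ‖w‖ - |g| * |C|) - (y ^ 2 + |g| * |C| * |y|) ≤
      κ.objective μ s P g y w := by
    intro w
    have h1 : g * κ.meanLin μ s P y w ≤ |g| * |C| * (|y| + ‖w‖) := by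
      calc g * κ.meanLin μ s P y w ≤ |g| * |κ.meanLin μ s P y w| := by
            rw [← abs_mul]; exact le_abs_self _
        _ ≤ |g| * (|C| * (|y| + ‖w‖)) := by
            gcongr
            refine (hC y w).trans ?_
            gcongr
            · exact le_abs_self C
            · rw [Prod.norm_mk]
              exact max_le_add_of_nonneg (norm_nonneg _) (norm_nonneg _)
        _ = _ := by ring
    have h2 := hV y w
    unfold objective
    linarith
  refine Filter.tendsto_atTop_mono hlow (Filter.tendsto_atTop_add_const_right _ _ ?_)
  have hnorm := tendsto_norm_cocompact_atTop (E := Fin n → ℝ)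
  exact hnorm.atTop_mul_atTop₀ (Filter.tendsto_atTop_add_const_right _ _
    (hnorm.const_mul_atTop hm))

end KinkCoef

end Surplus

/-! ### Integrals over sign regions as moments of positive and negative parts. -/

section PosNegParts

variable {Ω : Type*} [MeasurableSpace Ω] {μ : Measure Ω} {Z : Ω → ℝ}

/-- The integrand vanishes where `Z = 0`, so strict and weak sign regions give the same integral.
The variants below convert the conventions of both `F_t^+` and `F_t^-`. -/
theorem setIntegral_nonneg_mul (hZ : Measurable Z) (a : ℝ) :
    ∫ ω in {ω | 0 ≤ Z ω}, a * Z ω ∂μ = a * ∫ ω, max (Z ω) 0 ∂μ := by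
  rw [← integral_indicator (measurableSet_le measurable_const hZ), ← integral_const_mul]
  congr with ω
  by_cases h : 0 ≤ Z ω
  · simp [h]
  · simp [h, le_of_not_ge h]

theorem setIntegral_pos_mul (hZ : Measurable Z) (a : ℝ) :
    ∫ ω in {ω | 0 < Z ω}, a * Z ω ∂μ = a * ∫ ω, max (Z ω) 0 ∂μ := by
  rw [← integral_indicator (measurableSet_lt measurable_const hZ), ← integral_const_mul]
  congr with ω
  by_cases h : 0 < Z ω
  · simp [h, h.le]
  · simp [h, le_of_not_gt h]

theorem setIntegral_nonpos_mul (hZ : Measurable Z) (a : ℝ) :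
    ∫ ω in {ω | Z ω ≤ 0}, a * Z ω ∂μ = a * ∫ ω, min (Z ω) 0 ∂μ := by
  rw [← integral_indicator (measurableSet_le hZ measurable_const), ← integral_const_mul]
  congr with ω
  by_cases h : Z ω ≤ 0
  · simp [h]
  · simp [h, le_of_not_ge h]

theorem setIntegral_neg_mul (hZ : Measurable Z) (a : ℝ) :
    ∫ ω in {ω | Z ω < 0}, a * Z ω ∂μ = a * ∫ ω, min (Z ω) 0 ∂μ := by
  rw [← integral_indicator (measurableSet_lt hZ measurable_const), ← integral_const_mul]
  congr with ω
  by_cases h : Z ω < 0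
  · simp [h, h.le]
  · simp [h, le_of_not_gt h]

theorem setIntegral_nonneg_mul_sq (hZ : Measurable Z) (a : ℝ) :
    ∫ ω in {ω | 0 ≤ Z ω}, a * Z ω ^ 2 ∂μ = a * ∫ ω, max (Z ω) 0 ^ 2 ∂μ := by
  rw [← integral_indicator (measurableSet_le measurable_const hZ), ← integral_const_mul]
  congr with ω
  by_cases h : 0 ≤ Z ω
  · simp [h]
  · simp [h, le_of_not_ge h]

theorem setIntegral_pos_mul_sq (hZ : Measurable Z) (a : ℝ) :
    ∫ ω in {ω | 0 < Z ω}, a * Z ω ^ 2 ∂μ = a * ∫ ω, max (Z ω) 0 ^ 2 ∂μ := by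
  rw [← integral_indicator (measurableSet_lt measurable_const hZ), ← integral_const_mul]
  congr with ω
  by_cases h : 0 < Z ω
  · simp [h, h.le]
  · simp [h, le_of_not_gt h]

theorem setIntegral_nonpos_mul_sq (hZ : Measurable Z) (a : ℝ) :
    ∫ ω in {ω | Z ω ≤ 0}, a * Z ω ^ 2 ∂μ = a * ∫ ω, min (Z ω) 0 ^ 2 ∂μ := by
  rw [← integral_indicator (measurableSet_le hZ measurable_const), ← integral_const_mul]
  congr with ω
  by_cases h : Z ω ≤ 0
  · simp [h]
  · simp [h, le_of_not_ge h]

theorem setIntegral_neg_mul_sq (hZ : Measurable Z) (a : ℝ) :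
    ∫ ω in {ω | Z ω < 0}, a * Z ω ^ 2 ∂μ = a * ∫ ω, min (Z ω) 0 ^ 2 ∂μ := by
  rw [← integral_indicator (measurableSet_lt hZ measurable_const), ← integral_const_mul]
  congr with ω
  by_cases h : Z ω < 0
  · simp [h, h.le]
  · simp [h, le_of_not_gt h]

theorem MeasureTheory.MemLp.max_zero (hZ : MemLp Z 2 μ) : MemLp (fun ω => max (Z ω) 0) 2 μ := by
  simpa [KinkCoef.lin] using KinkCoef.memLp_lin ⟨1, 0, 0, 0⟩ hZ

theorem MeasureTheory.MemLp.min_zero (hZ : MemLp Z 2 μ) : MemLp (fun ω => min (Z ω) 0) 2 μ := by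
  simpa [KinkCoef.lin] using KinkCoef.memLp_lin ⟨0, 1, 0, 0⟩ hZ

theorem integral_max_neg : ∫ ω, max (-Z ω) 0 ∂μ = -∫ ω, min (Z ω) 0 ∂μ := by
  rw [← integral_neg]
  congr with ω
  rw [← neg_zero, max_neg_neg, neg_zero]

theorem integral_min_neg : ∫ ω, min (-Z ω) 0 ∂μ = -∫ ω, max (Z ω) 0 ∂μ := by
  rw [← integral_neg]
  congr with ω
  rw [← neg_zero, min_neg_neg, neg_zero]

theorem integral_max_neg_sq : ∫ ω, max (-Z ω) 0 ^ 2 ∂μ = ∫ ω, min (Z ω) 0 ^ 2 ∂μ := by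
  congr with ω
  rw [← neg_zero, max_neg_neg, neg_zero, neg_sq]

theorem integral_min_neg_sq : ∫ ω, min (-Z ω) 0 ^ 2 ∂μ = ∫ ω, max (Z ω) 0 ^ 2 ∂μ := by
  congr with ω
  rw [← neg_zero, min_neg_neg, neg_zero, neg_sq]

theorem integral_max_sq_add_integral_min_sq (hZ : MemLp Z 2 μ) :
    ∫ ω, max (Z ω) 0 ^ 2 ∂μ + ∫ ω, min (Z ω) 0 ^ 2 ∂μ = ∫ ω, Z ω ^ 2 ∂μ := by
  rw [← integral_add hZ.max_zero.integrable_sq hZ.min_zero.integrable_sq]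
  congr with ω
  rcases le_total 0 (Z ω) with h | h <;> simp [h]

theorem KinkCoef.integral_quad (κ : KinkCoef) (hZ : MemLp Z 2 μ) :
    ∫ ω, κ.quad (Z ω) ∂μ =
      κ.curvPos * ∫ ω, max (Z ω) 0 ^ 2 ∂μ + κ.curvNeg * ∫ ω, min (Z ω) 0 ^ 2 ∂μ := by
  simp only [KinkCoef.quad]
  rw [integral_add (hZ.max_zero.integrable_sq.const_mul _)
    (hZ.min_zero.integrable_sq.const_mul _), integral_const_mul, integral_const_mul]

variable [IsFiniteMeasure μ]

/-- Serves the mixed terms `R Q` in the formulas for `b_t^±`, where `Q = R - s_t`. -/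
theorem setIntegral_mul_mul_sub (hZ : MemLp Z 2 μ) (S : Set Ω) (a s : ℝ) :
    ∫ ω in S, a * Z ω * (Z ω - s) ∂μ =
      (∫ ω in S, a * Z ω ^ 2 ∂μ) - s * ∫ ω in S, a * Z ω ∂μ := by
  rw [← integral_const_mul, ← integral_sub (hZ.integrable_sq.const_mul a).integrableOn
    (((hZ.integrable one_le_two).const_mul a).const_mul s).integrableOn]
  congr with ω
  ring

theorem integral_max_add_integral_min (hZ : MemLp Z 2 μ) :
    ∫ ω, max (Z ω) 0 ∂μ + ∫ ω, min (Z ω) 0 ∂μ = ∫ ω, Z ω ∂μ := by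
  rw [← integral_add (hZ.max_zero.integrable one_le_two) (hZ.min_zero.integrable one_le_two)]
  congr with ω
  simp [max_add_min]

theorem KinkCoef.integral_lin (κ : KinkCoef) (hZ : MemLp Z 2 μ) :
    ∫ ω, κ.lin (Z ω) ∂μ =
      κ.slopePos * ∫ ω, max (Z ω) 0 ∂μ + κ.slopeNeg * ∫ ω, min (Z ω) 0 ∂μ := by
  simp only [KinkCoef.lin]
  rw [integral_add ((hZ.max_zero.integrable one_le_two).const_mul _)
    ((hZ.min_zero.integrable one_le_two).const_mul _), integral_const_mul, integral_const_mul]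

end PosNegParts

/-! ### The backward recursion in terms of surplus moments. -/

namespace PortfolioModel

variable {Ω : Type*} {n : ℕ} (M : PortfolioModel Ω n)

theorem ρ_eq_mul {t : ℕ} (ht : t < M.T) : M.ρ t = M.s t * M.ρ (t + 1) :=
  Finset.prod_eq_prod_Ico_succ_bot ht _

theorem ρ_T : M.ρ M.T = 1 := by simp [ρ]

/-- The coefficients of the conditional first and second moments, given the wealth at time `t`, of
the terminal surplus `X_T - W`. -/
noncomputable def surplusCoef (D : FundData n) (t : ℕ) : KinkCoef where
  slopePos := M.ρ t + D.ap t
  slopeNeg := M.ρ t + D.am t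
  curvPos := M.ρ t ^ 2 + 2 * M.ρ t * D.ap t + D.bp t
  curvNeg := M.ρ t ^ 2 + 2 * M.ρ t * D.am t + D.bm t

theorem P_dotProduct_eq (t : ℕ) (K : Fin n → ℝ) (ω : Ω) :
    M.P t ω ⬝ᵥ K = M.R t K ω - M.s t := by
  simp [R]

theorem nextSurplus_one (t : ℕ) (K : Fin n → ℝ) :
    nextSurplus (M.s t) (M.P t) 1 K = M.R t K := by
  ext ω; simp [nextSurplus, R]

/-- A unit shortage with feedback `K` means surplus `-1` and control `-K`. The resulting `-R` is the
origin of the reversed sign regions in `F_t^-`. -/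
theorem nextSurplus_neg_one (t : ℕ) (K : Fin n → ℝ) :
    nextSurplus (M.s t) (M.P t) (-1) (-K) = fun ω => -M.R t K ω := by
  ext ω; simp [nextSurplus, R]; ring

theorem valid_surplusCoef_T {D : FundData n}
    (h : D.ap M.T = 0 ∧ D.am M.T = 0 ∧ D.bp M.T = 0 ∧ D.bm M.T = 0) :
    (M.surplusCoef D M.T).Valid := by
  obtain ⟨h1, h2, h3, h4⟩ := h
  constructor <;> simp [surplusCoef, ρ_T, h1, h2, h3, h4]

variable [MeasurableSpace Ω] (μ : Measure Ω)

/-- The backward recursion at time `t`, expressed through the moments of the terminal surplus. -/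
structure IsRecursionAt (D : FundData n) (t : ℕ) : Prop where
  Kp_min : ∀ K, (M.surplusCoef D (t + 1)).objective μ (M.s t) (M.P t) (M.γp t) 1 (D.Kp t) ≤
    (M.surplusCoef D (t + 1)).objective μ (M.s t) (M.P t) (M.γp t) 1 K
  Km_min : ∀ K, (M.surplusCoef D (t + 1)).objective μ (M.s t) (M.P t) (M.γm t) (-1) (-D.Km t) ≤
    (M.surplusCoef D (t + 1)).objective μ (M.s t) (M.P t) (M.γm t) (-1) (-K)
  slopePos_eq : (M.surplusCoef D t).slopePos =
    (M.surplusCoef D (t + 1)).meanLin μ (M.s t) (M.P t) 1 (D.Kp t)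
  slopeNeg_eq : (M.surplusCoef D t).slopeNeg =
    -(M.surplusCoef D (t + 1)).meanLin μ (M.s t) (M.P t) (-1) (-D.Km t)
  curvPos_eq : (M.surplusCoef D t).curvPos =
    (M.surplusCoef D (t + 1)).meanQuad μ (M.s t) (M.P t) 1 (D.Kp t)
  curvNeg_eq : (M.surplusCoef D t).curvNeg =
    (M.surplusCoef D (t + 1)).meanQuad μ (M.s t) (M.P t) (-1) (-D.Km t)

variable {M μ} {t : ℕ}

theorem memLp_P [IsFiniteMeasure μ] (h : MemLp (M.e t) 2 μ) : MemLp (M.P t) 2 μ :=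
  h.sub (memLp_const fun _ => M.s t)

theorem measurable_P (h : Measurable (M.e t)) : Measurable (M.P t) :=
  h.sub (measurable_const (a := fun _ => M.s t))

/-- The event `P_t ⬝ᵥ w = c` says that `e_t` lies on a hyperplane, shifted by the riskless return;
its law does not charge it. -/
theorem atomlessCombinations_P (hm : Measurable (M.e t)) (h : μ.map (M.e t) ≪ volume) :
    AtomlessCombinations μ (M.P t) := by
  intro w hw c
  have h0 := h (volume_dotProduct_eq hw (c + (fun _ => M.s t) ⬝ᵥ w))
  refine measure_mono_null ?_
    (nonpos_iff_eq_zero.1 ((Measure.le_map_apply hm.aemeasurable _).trans h0.le))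
  intro ω hω
  simp only [ne_eq, Set.mem_compl_iff, Set.mem_ofPred_eq, not_not] at hω
  simp only [Set.mem_preimage, Set.mem_ofPred_eq, ← hω, ← add_dotProduct]
  congr 1
  ext i
  simp [P]

theorem integral_P_dotProduct (hP : MemLp (M.P t) 2 μ) [IsFiniteMeasure μ] (K : Fin n → ℝ) :
    ∫ ω, M.P t ω ⬝ᵥ K ∂μ = M.meanP μ t ⬝ᵥ K := by
  simp only [dotProduct, meanP]
  rw [integral_finsetSum _ fun i _ => ((hP.eval i).integrable one_le_two).mul_const _]
  simp only [integral_mul_const]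

theorem integral_P_dotProduct_sq (hP : MemLp (M.P t) 2 μ) (K : Fin n → ℝ) :
    ∫ ω, (M.P t ω ⬝ᵥ K) ^ 2 ∂μ = K ⬝ᵥ M.secondP μ t *ᵥ K := by
  have hint (i j) : Integrable (fun ω => M.P t ω i * M.P t ω j) μ :=
    (hP.eval i).integrable_mul (hP.eval j)
  have h1 (ω) : (M.P t ω ⬝ᵥ K) ^ 2 = ∑ i, ∑ j, K i * K j * (M.P t ω i * M.P t ω j) := by
    simp only [dotProduct, sq, Finset.sum_mul_sum]
    exact Finset.sum_congr rfl fun i _ => Finset.sum_congr rfl fun j _ => by ring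
  simp only [h1]
  rw [integral_finsetSum _ fun i _ => integrable_finsetSum _ fun j _ => (hint i j).const_mul _]
  simp only [dotProduct, Matrix.mulVec, secondP, Matrix.of_apply, Finset.mul_sum]
  refine Finset.sum_congr rfl fun i _ => ?_
  rw [integral_finsetSum _ fun j _ => (hint i j).const_mul _]
  refine Finset.sum_congr rfl fun j _ => ?_
  rw [integral_const_mul]
  ring

variable [IsProbabilityMeasure μ]

theorem memLp_R (hP : MemLp (M.P t) 2 μ) (K : Fin n → ℝ) : MemLp (M.R t K) 2 μ :=
  (memLp_const (M.s t)).add (memLp_dotProduct hP K)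

theorem measurable_R (hP : Measurable (M.P t)) (K : Fin n → ℝ) : Measurable (M.R t K) := by
  unfold R dotProduct
  fun_prop

theorem integral_R (hP : MemLp (M.P t) 2 μ) (K : Fin n → ℝ) :
    ∫ ω, M.R t K ω ∂μ = M.s t + M.meanP μ t ⬝ᵥ K := by
  unfold R
  rw [integral_add (integrable_const _) ((memLp_dotProduct hP K).integrable one_le_two),
    integral_P_dotProduct hP]
  simp

theorem meanP_dotProduct_eq (hP : MemLp (M.P t) 2 μ) (K : Fin n → ℝ) :
    M.meanP μ t ⬝ᵥ K =
      ∫ ω, max (M.R t K ω) 0 ∂μ + ∫ ω, min (M.R t K ω) 0 ∂μ - M.s t := by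
  rw [integral_max_add_integral_min (memLp_R hP K), integral_R hP]
  ring

theorem secondP_dotProduct_eq (hP : MemLp (M.P t) 2 μ) (K : Fin n → ℝ) :
    K ⬝ᵥ M.secondP μ t *ᵥ K =
      ∫ ω, max (M.R t K ω) 0 ^ 2 ∂μ + ∫ ω, min (M.R t K ω) 0 ^ 2 ∂μ
        - 2 * M.s t * (∫ ω, max (M.R t K ω) 0 ∂μ + ∫ ω, min (M.R t K ω) 0 ∂μ) + M.s t ^ 2 := by
  have hR := memLp_R hP K
  rw [integral_max_sq_add_integral_min_sq hR, integral_max_add_integral_min hR, ← integral_const_mul,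
    ← integral_sub hR.integrable_sq ((hR.integrable one_le_two).const_mul _),
    ← integral_P_dotProduct_sq hP]
  have h (ω) : (M.P t ω ⬝ᵥ K) ^ 2 =
      M.R t K ω ^ 2 - 2 * M.s t * M.R t K ω + M.s t ^ 2 := by
    simp only [R]; ring
  simp only [h]
  have hint : Integrable (fun ω => M.R t K ω ^ 2 - 2 * M.s t * M.R t K ω) μ :=
    hR.integrable_sq.sub ((hR.integrable one_le_two).const_mul _)
  rw [integral_add hint (integrable_const _)]
  simp

theorem dotProduct_vecMulVec_mulVec (m K : Fin n → ℝ) :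
    K ⬝ᵥ Matrix.vecMulVec m m *ᵥ K = (m ⬝ᵥ K) ^ 2 := by
  rw [Matrix.vecMulVec_mulVec, op_smul_eq_smul, dotProduct_smul, dotProduct_comm K m, smul_eq_mul,
    sq]

theorem meanLin_one (κ : KinkCoef) (hP : MemLp (M.P t) 2 μ) (K : Fin n → ℝ) :
    κ.meanLin μ (M.s t) (M.P t) 1 K =
      κ.slopePos * ∫ ω, max (M.R t K ω) 0 ∂μ + κ.slopeNeg * ∫ ω, min (M.R t K ω) 0 ∂μ := by
  rw [KinkCoef.meanLin, nextSurplus_one, κ.integral_lin (memLp_R hP K)]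

theorem meanQuad_one (κ : KinkCoef) (hP : MemLp (M.P t) 2 μ) (K : Fin n → ℝ) :
    κ.meanQuad μ (M.s t) (M.P t) 1 K =
      κ.curvPos * ∫ ω, max (M.R t K ω) 0 ^ 2 ∂μ + κ.curvNeg * ∫ ω, min (M.R t K ω) 0 ^ 2 ∂μ := by
  rw [KinkCoef.meanQuad, nextSurplus_one, κ.integral_quad (memLp_R hP K)]

theorem meanLin_neg_one (κ : KinkCoef) (hP : MemLp (M.P t) 2 μ) (K : Fin n → ℝ) :
    κ.meanLin μ (M.s t) (M.P t) (-1) (-K) =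
      -(κ.slopePos * ∫ ω, min (M.R t K ω) 0 ∂μ + κ.slopeNeg * ∫ ω, max (M.R t K ω) 0 ∂μ) := by
  rw [KinkCoef.meanLin, nextSurplus_neg_one, κ.integral_lin (Z := fun ω => -M.R t K ω) (memLp_R hP K).neg]
  simp only [integral_max_neg, integral_min_neg]
  ring

theorem meanQuad_neg_one (κ : KinkCoef) (hP : MemLp (M.P t) 2 μ) (K : Fin n → ℝ) :
    κ.meanQuad μ (M.s t) (M.P t) (-1) (-K) =
      κ.curvPos * ∫ ω, min (M.R t K ω) 0 ^ 2 ∂μ + κ.curvNeg * ∫ ω, max (M.R t K ω) 0 ^ 2 ∂μ := by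
  rw [KinkCoef.meanQuad, nextSurplus_neg_one, κ.integral_quad (Z := fun ω => -M.R t K ω) (memLp_R hP K).neg]
  simp only [integral_max_neg_sq, integral_min_neg_sq]

/-- Both sides are the same polynomial in the first and second moments of the positive and negative
parts of `R`. -/
theorem Fp_eq_objective (D : FundData n) (hPm : Measurable (M.P t)) (hP : MemLp (M.P t) 2 μ)
    (K : Fin n → ℝ) :
    M.Fp μ D t K = (M.surplusCoef D (t + 1)).objective μ (M.s t) (M.P t) (M.γp t) 1 K := by
  have hRm := measurable_R hPm K
  rw [KinkCoef.objective, meanLin_one _ hP, meanQuad_one _ hP, Fp, Matrix.sub_mulVec,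
    dotProduct_sub, dotProduct_vecMulVec_mulVec]
  simp only [setIntegral_nonneg_mul hRm, setIntegral_neg_mul hRm, setIntegral_nonneg_mul_sq hRm,
    setIntegral_neg_mul_sq hRm, meanP_dotProduct_eq hP K, secondP_dotProduct_eq hP K, surplusCoef]
  ring

theorem Fm_eq_objective (D : FundData n) (hPm : Measurable (M.P t)) (hP : MemLp (M.P t) 2 μ)
    (K : Fin n → ℝ) :
    M.Fm μ D t K =
      (M.surplusCoef D (t + 1)).objective μ (M.s t) (M.P t) (M.γm t) (-1) (-K) := by
  have hRm := measurable_R hPm K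
  rw [KinkCoef.objective, meanLin_neg_one _ hP, meanQuad_neg_one _ hP, Fm, Matrix.sub_mulVec,
    dotProduct_sub, dotProduct_vecMulVec_mulVec]
  simp only [setIntegral_nonpos_mul hRm, setIntegral_pos_mul hRm, setIntegral_nonpos_mul_sq hRm,
    setIntegral_pos_mul_sq hRm, meanP_dotProduct_eq hP K, secondP_dotProduct_eq hP K, surplusCoef]
  ring

theorem isBackwardSolution_iff {D : FundData n} (hPm : ∀ t < M.T, Measurable (M.P t))
    (hP : ∀ t < M.T, MemLp (M.P t) 2 μ) :
    M.IsBackwardSolution μ D ↔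
      (D.ap M.T = 0 ∧ D.am M.T = 0 ∧ D.bp M.T = 0 ∧ D.bm M.T = 0) ∧
        ∀ t < M.T, M.IsRecursionAt μ D t := by
  constructor
  · intro h
    refine ⟨⟨h.ap_T, h.am_T, h.bp_T, h.bm_T⟩, fun t ht => ?_⟩
    have hρ := M.ρ_eq_mul ht
    have hRp := measurable_R (hPm t ht) (D.Kp t)
    have hRn := measurable_R (hPm t ht) (D.Km t)
    have hap := h.ap_eq t ht
    have ham := h.am_eq t ht
    have hbp := h.bp_eq t ht
    have hbm := h.bm_eq t ht
    simp only [M.P_dotProduct_eq, setIntegral_mul_mul_sub (memLp_R (hP t ht) _),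
      setIntegral_nonneg_mul hRp, setIntegral_neg_mul hRp, setIntegral_nonneg_mul_sq hRp,
      setIntegral_neg_mul_sq hRp, setIntegral_nonpos_mul hRn, setIntegral_pos_mul hRn,
      setIntegral_nonpos_mul_sq hRn, setIntegral_pos_mul_sq hRn, meanP_dotProduct_eq (hP t ht),
      secondP_dotProduct_eq (hP t ht)] at hap ham hbp hbm
    constructor
    · intro K
      simpa only [Fp_eq_objective D (hPm t ht) (hP t ht)] using h.Kp_min t ht K
    · intro K
      simpa only [Fm_eq_objective D (hPm t ht) (hP t ht)] using h.Km_min t ht K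
    · rw [meanLin_one _ (hP t ht)]
      simp only [surplusCoef]
      rw [hap, hρ]; ring
    · rw [meanLin_neg_one _ (hP t ht)]
      simp only [surplusCoef]
      rw [ham, hρ]; ring
    · rw [meanQuad_one _ (hP t ht)]
      simp only [surplusCoef]
      rw [hbp, hap, hρ]; ring
    · rw [meanQuad_neg_one _ (hP t ht)]
      simp only [surplusCoef]
      rw [hbm, ham, hρ]; ring
  · rintro ⟨⟨h1, h2, h3, h4⟩, h⟩
    have hap : ∀ t < M.T, _ := fun t ht =>
      ((h t ht).slopePos_eq.trans (meanLin_one _ (hP t ht) (D.Kp t)))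
    have ham : ∀ t < M.T, _ := fun t ht =>
      ((h t ht).slopeNeg_eq.trans (congrArg Neg.neg (meanLin_neg_one _ (hP t ht) (D.Km t))))
    have hbp : ∀ t < M.T, _ := fun t ht =>
      ((h t ht).curvPos_eq.trans (meanQuad_one _ (hP t ht) (D.Kp t)))
    have hbm : ∀ t < M.T, _ := fun t ht =>
      ((h t ht).curvNeg_eq.trans (meanQuad_neg_one _ (hP t ht) (D.Km t)))
    simp only [surplusCoef] at hap ham hbp hbm
    refine ⟨h1, h2, h3, h4, ?_, ?_, ?_, ?_, ?_, ?_⟩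
    · intro t ht K
      simpa only [Fp_eq_objective D (hPm t ht) (hP t ht)] using (h t ht).Kp_min K
    · intro t ht K
      simpa only [Fm_eq_objective D (hPm t ht) (hP t ht)] using (h t ht).Km_min K
    all_goals
      intro t ht
      have hρ := M.ρ_eq_mul ht
      have hRp := measurable_R (hPm t ht) (D.Kp t)
      have hRn := measurable_R (hPm t ht) (D.Km t)
      have hap := hap t ht
      have ham := ham t ht
      have hbp := hbp t ht
      have hbm := hbm t ht
      rw [hρ] at hap ham hbp hbm
      simp only [M.P_dotProduct_eq, setIntegral_mul_mul_sub (memLp_R (hP t ht) _),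
        setIntegral_nonneg_mul hRp, setIntegral_neg_mul hRp, setIntegral_nonneg_mul_sq hRp,
        setIntegral_neg_mul_sq hRp, setIntegral_nonpos_mul hRn, setIntegral_pos_mul hRn,
        setIntegral_nonpos_mul_sq hRn, setIntegral_pos_mul_sq hRn, meanP_dotProduct_eq (hP t ht),
        secondP_dotProduct_eq (hP t ht)]
    · linear_combination hap
    · linear_combination ham
    -- The curvature contains `2 ρ_t a_t` with `ρ_t = s_t ρ_{t+1}`; subtracting this multiple of the
    -- slope equation isolates `b_t`.
    · linear_combination hbp - 2 * M.s t * M.ρ (t + 1) * hap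
    · linear_combination hbm - 2 * M.s t * M.ρ (t + 1) * ham

theorem IsRecursionAt.valid {D : FundData n} (hs : M.s t ≠ 0) (hP : MemLp (M.P t) 2 μ)
    (hPa : AtomlessCombinations μ (M.P t)) (h : M.IsRecursionAt μ D t)
    (hv : (M.surplusCoef D (t + 1)).Valid) : (M.surplusCoef D t).Valid where
  curvPos_pos := by
    rw [h.curvPos_eq]; exact hv.meanQuad_pos hs hP hPa one_ne_zero _
  curvNeg_pos := by
    rw [h.curvNeg_eq]; exact hv.meanQuad_pos hs hP hPa (neg_ne_zero.2 one_ne_zero) _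
  sq_slopePos_le := by
    rw [h.curvPos_eq, h.slopePos_eq]; exact hv.sq_meanLin_le hP _ _
  sq_slopeNeg_le := by
    rw [h.curvNeg_eq, h.slopeNeg_eq, neg_sq]; exact hv.sq_meanLin_le hP _ _

/-- The recursion is required only from `t₀` onwards, so that validity is already available for data
still under construction. -/
theorem valid_surplusCoef {D : FundData n} (hs : ∀ t < M.T, M.s t ≠ 0)
    (hP : ∀ t < M.T, MemLp (M.P t) 2 μ) (hPa : ∀ t < M.T, AtomlessCombinations μ (M.P t))
    (hT : D.ap M.T = 0 ∧ D.am M.T = 0 ∧ D.bp M.T = 0 ∧ D.bm M.T = 0) {t₀ : ℕ}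
    (h : ∀ t < M.T, t₀ ≤ t → M.IsRecursionAt μ D t) (ht₀ : t₀ ≤ M.T) :
    (M.surplusCoef D t₀).Valid := by
  induction ht₀ using Nat.decreasingInduction with
  | self => exact M.valid_surplusCoef_T hT
  | of_succ k hk ih =>
    exact (h k hk le_rfl).valid (hs k hk) (hP k hk) (hPa k hk)
      (ih fun t ht hkt => h t ht (Nat.le_of_succ_le hkt))

variable (M μ) in
theorem exists_isRecursionAt (hs : ∀ t < M.T, M.s t ≠ 0)
    (hP : ∀ t < M.T, MemLp (M.P t) 2 μ) (hPa : ∀ t < M.T, AtomlessCombinations μ (M.P t))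
    {t₀ : ℕ} (ht₀ : t₀ ≤ M.T) :
    ∃ D : FundData n, (D.ap M.T = 0 ∧ D.am M.T = 0 ∧ D.bp M.T = 0 ∧ D.bm M.T = 0) ∧
      ∀ t < M.T, t₀ ≤ t → M.IsRecursionAt μ D t := by
  induction ht₀ using Nat.decreasingInduction with
  | self => exact ⟨⟨0, 0, 0, 0, 0, 0⟩, by simp, fun t ht ht' => absurd ht ht'.not_gt⟩
  | of_succ k hk ih =>
    obtain ⟨D, hT, hD⟩ := ih
    have hv := valid_surplusCoef hs hP hPa hT hD hk
    obtain ⟨K₁, hK₁⟩ := hv.exists_forall_objective_le (s := M.s k) (hP k hk) (hPa k hk) (M.γp k) 1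
    obtain ⟨K₂, hK₂⟩ :=
      hv.exists_forall_objective_le (s := M.s k) (hP k hk) (hPa k hk) (M.γm k) (-1)
    set κ := M.surplusCoef D (k + 1) with hκ
    -- The parameters at time `k` are solved from the slope and curvature equations.
    let ap := κ.meanLin μ (M.s k) (M.P k) 1 K₁ - M.ρ k
    let am := -κ.meanLin μ (M.s k) (M.P k) (-1) K₂ - M.ρ k
    let D' : FundData n :=
      { Kp := Function.update D.Kp k K₁
        -- `K₂` minimizes the objective at surplus `-1`, where the control is minus the fund.
        Km := Function.update D.Km k (-K₂)
        ap := Function.update D.ap k ap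
        am := Function.update D.am k am
        bp := Function.update D.bp k
          (κ.meanQuad μ (M.s k) (M.P k) 1 K₁ - M.ρ k ^ 2 - 2 * M.ρ k * ap)
        bm := Function.update D.bm k
          (κ.meanQuad μ (M.s k) (M.P k) (-1) K₂ - M.ρ k ^ 2 - 2 * M.ρ k * am) }
    have hcoef (t : ℕ) (ht : t ≠ k) : M.surplusCoef D' t = M.surplusCoef D t := by
      simp [D', surplusCoef, ht]
    refine ⟨D', by simpa [D', hk.ne'] using hT, fun t ht hkt => ?_⟩
    rcases hkt.eq_or_lt with rfl | hlt
    · have hc : M.surplusCoef D' (k + 1) = κ := hcoef _ (Nat.succ_ne_self k)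
      constructor <;> rw [hc]
      · simpa [D'] using hK₁
      · simpa [D'] using fun K => hK₂ (-K)
      · simp [D', surplusCoef, ap]
      · simp [D', surplusCoef, am]
      · simp [D', surplusCoef]
      · simp [D', surplusCoef]
    -- At times after `k` the recursion involves only entries that the update leaves alone.
    · have h := hD t ht hlt
      have hKp : D'.Kp t = D.Kp t := Function.update_of_ne hlt.ne' _ _
      have hKm : D'.Km t = D.Km t := Function.update_of_ne hlt.ne' _ _
      constructor <;> rw [hcoef (t + 1) (by omega)]
      · rw [hKp]; exact h.Kp_min
      · rw [hKm]; exact h.Km_min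
      · rw [hKp, hcoef t hlt.ne']; exact h.slopePos_eq
      · rw [hKm, hcoef t hlt.ne']; exact h.slopeNeg_eq
      · rw [hKp, hcoef t hlt.ne']; exact h.curvPos_eq
      · rw [hKm, hcoef t hlt.ne']; exact h.curvNeg_eq

end PortfolioModel

/-! ### Wealth dynamics, optimal feedback and conditional moments. -/

namespace PortfolioModel

variable {Ω : Type*} {n : ℕ} (M : PortfolioModel Ω n) {t : ℕ}

section Dynamics

/-- The wealth is defined by appending a last period; backward induction needs the first one split
off. -/
theorem wealth_succ_left (u : ℕ → ℝ → Fin n → ℝ) (t : ℕ) (ξ : Ω → ℝ) (k : ℕ) :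
    M.wealth u t ξ (k + 1) =
      M.wealth u (t + 1) (fun ω => M.s t * ξ ω + M.P t ω ⬝ᵥ u t (ξ ω)) k := by
  induction k with
  | zero => rfl
  | succ k ih =>
    rw [wealth, ih, wealth, show t + (k + 1) = t + 1 + k by omega]

theorem wealth_congr {u u' : ℕ → ℝ → Fin n → ℝ} {t k : ℕ}
    (h : ∀ j, t ≤ j → j < t + k → ∀ x, u j x = u' j x) (ξ : Ω → ℝ) :
    M.wealth u t ξ k = M.wealth u' t ξ k := by
  induction k with
  | zero => rfl
  | succ k ih =>
    simp only [wealth, ih fun j hj hjk => h j hj (by omega)]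
    ext ω
    rw [h (t + k) (by omega) (by omega)]

/-- The wealth at time `t + 1` if the wealth at time `t` is `ξ` and `v` is followed at time `t`. -/
def nextWealth (t : ℕ) (ξ : Ω → ℝ) (v : ℝ → Fin n → ℝ) (ω : Ω) : ℝ :=
  M.s t * ξ ω + M.P t ω ⬝ᵥ v (ξ ω)

theorem terminalWealth_eq_nextWealth (ht : t < M.T) (u : ℕ → ℝ → Fin n → ℝ) (ξ : Ω → ℝ) :
    M.terminalWealth u t ξ = M.terminalWealth u (t + 1) (M.nextWealth t ξ (u t)) := by
  rw [terminalWealth, terminalWealth, show M.T - t = M.T - (t + 1) + 1 by omega,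
    wealth_succ_left]
  rfl

theorem terminalWealth_congr {u u' : ℕ → ℝ → Fin n → ℝ} (ht : t ≤ M.T)
    (h : ∀ j, t ≤ j → j < M.T → ∀ x, u j x = u' j x) (ξ : Ω → ℝ) :
    M.terminalWealth u t ξ = M.terminalWealth u' t ξ :=
  M.wealth_congr (fun j hj hjT => h j hj (by omega)) ξ

theorem terminalWealth_T (u : ℕ → ℝ → Fin n → ℝ) (ξ : Ω → ℝ) :
    M.terminalWealth u M.T ξ = ξ := by
  simp [terminalWealth, wealth]

theorem target_T : M.target M.T = M.W := by simp [target, ρ_T]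

theorem s_mul_target (ht : t < M.T) (hs : M.s t ≠ 0) :
    M.s t * M.target t = M.target (t + 1) := by
  simp only [target, M.ρ_eq_mul ht, mul_inv]
  field_simp

theorem nextWealth_sub_target (ht : t < M.T) (hs : M.s t ≠ 0) (ξ : Ω → ℝ) (v : ℝ → Fin n → ℝ)
    (ω : Ω) : M.nextWealth t ξ v ω - M.target (t + 1) =
      nextSurplus (M.s t) (M.P t) (ξ ω - M.target t) (v (ξ ω)) ω := by
  rw [← M.s_mul_target ht hs, nextWealth, nextSurplus]
  ring

theorem measurable_policy (D : FundData n) (t : ℕ) : Measurable (M.policy D t) := by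
  unfold policy
  exact Measurable.ite measurableSet_Ici (by fun_prop) (by fun_prop)

theorem norm_policy_le (D : FundData n) (t : ℕ) (x : ℝ) :
    ‖M.policy D t x‖ ≤ (‖D.Kp t‖ + ‖D.Km t‖) * ‖x - M.target t‖ := by
  unfold policy
  split_ifs
  · rw [norm_smul, mul_comm]
    gcongr
    linarith [norm_nonneg (D.Km t)]
  · rw [norm_smul, mul_comm]
    gcongr
    linarith [norm_nonneg (D.Kp t)]

theorem filtration_mono (t : ℕ) : M.𝓕 t ≤ M.𝓕 (t + 1) :=
  iSup_le fun j => le_iSup (fun j : Fin (t + 1) => MeasurableSpace.comap (M.e j) inferInstance)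
    j.castSucc

theorem measurable_P_filtration (t : ℕ) :
    Measurable[M.𝓕 (t + 1)] (M.P t) := by
  have he : Measurable[M.𝓕 (t + 1)] (M.e t) :=
    (comap_measurable (M.e t)).mono (le_iSup (fun j : Fin (t + 1) =>
      MeasurableSpace.comap (M.e j) inferInstance) (Fin.last t)) le_rfl
  exact (measurable_id.sub (measurable_const (a := fun _ : Fin n => M.s t))).comp he

theorem measurable_nextWealth {ξ : Ω → ℝ} {v : ℝ → Fin n → ℝ}
    (hξ : Measurable[M.𝓕 t] ξ)
    (hv : Measurable v) : Measurable[M.𝓕 (t + 1)] (M.nextWealth t ξ v) := by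
  have hξ' : Measurable[M.𝓕 (t + 1)] ξ := hξ.mono (M.filtration_mono t) le_rfl
  have hpair : Measurable[M.𝓕 (t + 1)] fun ω => (ξ ω, M.P t ω) :=
    hξ'.prodMk (M.measurable_P_filtration t)
  have hF : Measurable fun p : ℝ × (Fin n → ℝ) => M.s t * p.1 + p.2 ⬝ᵥ v p.1 := by
    unfold dotProduct; fun_prop
  exact hF.comp hpair

end Dynamics

variable {M}

section Optimality

theorem inv_smul_policy_of_target_lt (D : FundData n) {x : ℝ} (hx : M.target t < x) :
    (x - M.target t)⁻¹ • M.policy D t x = D.Kp t := by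
  rw [policy, if_pos hx.le, inv_smul_smul₀ (sub_pos.2 hx).ne']

theorem inv_smul_policy_of_lt_target (D : FundData n) {x : ℝ} (hx : x < M.target t) :
    (x - M.target t)⁻¹ • M.policy D t x = D.Km t := by
  rw [policy, if_neg hx.not_ge, inv_smul_smul₀ (sub_neg.2 hx).ne]

theorem γ_target : M.γ t (M.target t) = 0 := by simp [γ]

theorem policy_target (D : FundData n) : M.policy D t (M.target t) = 0 := by simp [policy]

variable [MeasurableSpace Ω] {μ : Measure Ω} {D : FundData n}

/-- By homogeneity, the mean at surplus `y` is `|y|` times the one at `±1`, which the recursion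
stores as a slope. -/
theorem IsRecursionAt.meanLin_policy (h : M.IsRecursionAt μ D t) (x : ℝ) :
    (M.surplusCoef D (t + 1)).meanLin μ (M.s t) (M.P t) (x - M.target t) (M.policy D t x) =
      (M.surplusCoef D t).lin (x - M.target t) := by
  unfold policy
  split_ifs with hx
  · have hy := sub_nonneg.2 hx
    have := (M.surplusCoef D (t + 1)).meanLin_smul μ (s := M.s t) (M.P t) hy 1 (D.Kp t)
    rw [mul_one] at this
    rw [this, KinkCoef.lin_of_nonneg _ hy, h.slopePos_eq, mul_comm]
  · have hy : 0 ≤ -(x - M.target t) := by linarith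
    have := (M.surplusCoef D (t + 1)).meanLin_smul μ (s := M.s t) (M.P t) hy (-1)
      (-D.Km t)
    rw [neg_mul_neg, mul_one, neg_smul_neg] at this
    rw [this, KinkCoef.lin_of_nonpos _ (neg_nonneg.1 hy), h.slopeNeg_eq]
    ring

theorem IsRecursionAt.meanQuad_policy (h : M.IsRecursionAt μ D t) (x : ℝ) :
    (M.surplusCoef D (t + 1)).meanQuad μ (M.s t) (M.P t) (x - M.target t) (M.policy D t x) =
      (M.surplusCoef D t).quad (x - M.target t) := by
  unfold policy
  split_ifs with hx
  · have hy := sub_nonneg.2 hx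
    have := (M.surplusCoef D (t + 1)).meanQuad_smul μ (s := M.s t) (M.P t) hy 1 (D.Kp t)
    rw [mul_one] at this
    rw [this, KinkCoef.quad_of_nonneg _ hy, h.curvPos_eq, mul_comm]
  · have hy : 0 ≤ -(x - M.target t) := by linarith
    have := (M.surplusCoef D (t + 1)).meanQuad_smul μ (s := M.s t) (M.P t) hy (-1)
      (-D.Km t)
    rw [neg_mul_neg, mul_one, neg_smul_neg] at this
    rw [this, KinkCoef.quad_of_nonpos _ (neg_nonneg.1 hy), h.curvNeg_eq]
    ring

/-- Above the target, the objective is a multiple of the one with unit surplus. -/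
theorem objective_of_target_lt (κ : KinkCoef) {x : ℝ} (hx : M.target t < x) (w : Fin n → ℝ) :
    κ.objective μ (M.s t) (M.P t) (M.γ t x) (x - M.target t) w =
      (x - M.target t) ^ 2 *
        κ.objective μ (M.s t) (M.P t) (M.γp t) 1 ((x - M.target t)⁻¹ • w) := by
  have hy : 0 < x - M.target t := sub_pos.2 hx
  rw [← κ.objective_smul μ (M.P t) hy.le, smul_inv_smul₀ hy.ne', mul_one, γ, if_pos hx.le,
    mul_comm]

/-- Below the target, the objective is a multiple of the one with unit shortage. -/
theorem objective_of_lt_target (κ : KinkCoef) {x : ℝ} (hx : x < M.target t) (w : Fin n → ℝ) :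
    κ.objective μ (M.s t) (M.P t) (M.γ t x) (x - M.target t) w =
      (x - M.target t) ^ 2 *
        κ.objective μ (M.s t) (M.P t) (M.γm t) (-1) (-((x - M.target t)⁻¹ • w)) := by
  have hy : 0 < -(x - M.target t) := by linarith
  rw [← neg_sq (x - M.target t), ← κ.objective_smul μ (M.P t) hy.le, neg_smul_neg,
    smul_inv_smul₀ (neg_ne_zero.1 hy.ne'), neg_mul_neg, mul_one, γ, if_neg hx.not_ge, neg_mul,
    neg_mul, mul_comm]

variable [IsProbabilityMeasure μ]

theorem IsRecursionAt.objective_policy_le (h : M.IsRecursionAt μ D t)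
    (hv : (M.surplusCoef D (t + 1)).Valid) (hP : MemLp (M.P t) 2 μ) (x : ℝ) (w : Fin n → ℝ) :
    (M.surplusCoef D (t + 1)).objective μ (M.s t) (M.P t) (M.γ t x) (x - M.target t)
        (M.policy D t x) ≤
      (M.surplusCoef D (t + 1)).objective μ (M.s t) (M.P t) (M.γ t x) (x - M.target t) w := by
  rcases lt_trichotomy (M.target t) x with hx | hx | hx
  · rw [objective_of_target_lt _ hx, objective_of_target_lt _ hx, inv_smul_policy_of_target_lt D hx]
    gcongr
    exact h.Kp_min _
  -- At the target the risk aversion vanishes: no investment costs `0`, while any other control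
  -- costs a nonnegative variance.
  · rw [← hx, policy_target, γ_target, sub_self]
    have h0 : (M.surplusCoef D (t + 1)).objective μ (M.s t) (M.P t) 0 0 0 = 0 := by
      simp [KinkCoef.objective, KinkCoef.meanLin, KinkCoef.meanQuad, nextSurplus, KinkCoef.lin,
        KinkCoef.quad]
    rw [h0, KinkCoef.objective, zero_mul, sub_zero]
    exact sub_nonneg.2 (hv.sq_meanLin_le hP _ _)
  · rw [objective_of_lt_target _ hx, objective_of_lt_target _ hx, inv_smul_policy_of_lt_target D hx]
    gcongr
    exact h.Km_min _

theorem eq_policy_of_forall_objective_le (hv : (M.surplusCoef D (t + 1)).Valid) (hP : MemLp (M.P t) 2 μ)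
    (hPa : AtomlessCombinations μ (M.P t))
    (hup : ∀ K, (∀ K', (M.surplusCoef D (t + 1)).objective μ (M.s t) (M.P t) (M.γp t) 1 K ≤
      (M.surplusCoef D (t + 1)).objective μ (M.s t) (M.P t) (M.γp t) 1 K') → K = D.Kp t)
    (hum : ∀ K, (∀ K', (M.surplusCoef D (t + 1)).objective μ (M.s t) (M.P t) (M.γm t) (-1) (-K) ≤
      (M.surplusCoef D (t + 1)).objective μ (M.s t) (M.P t) (M.γm t) (-1) (-K')) → K = D.Km t)
    {x : ℝ} {w : Fin n → ℝ}
    (hw : ∀ w', (M.surplusCoef D (t + 1)).objective μ (M.s t) (M.P t) (M.γ t x)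
        (x - M.target t) w ≤
      (M.surplusCoef D (t + 1)).objective μ (M.s t) (M.P t) (M.γ t x) (x - M.target t) w') :
    w = M.policy D t x := by
  rcases lt_trichotomy (M.target t) x with hx | hx | hx
  · have hy : 0 < x - M.target t := sub_pos.2 hx
    simp only [objective_of_target_lt _ hx, mul_le_mul_iff_right₀ (pow_pos hy 2)] at hw
    rw [policy, if_pos hx.le, ← hup ((x - M.target t)⁻¹ • w), smul_inv_smul₀ hy.ne']
    intro K'
    simpa [inv_smul_smul₀ hy.ne'] using hw ((x - M.target t) • K')
  · rw [← hx, policy_target]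
    -- At the target a nonzero investment has strictly positive variance, so comparison with `0`
    -- excludes it; uniqueness of the funds plays no role here.
    by_contra hw0
    have := hw 0
    rw [← hx, γ_target, sub_self] at this
    simp only [KinkCoef.objective, zero_mul, sub_zero] at this
    have h0 : (M.surplusCoef D (t + 1)).meanQuad μ (M.s t) (M.P t) 0 0 = 0 := by
      simp [KinkCoef.meanQuad, nextSurplus, KinkCoef.quad]
    nlinarith [hv.sq_meanLin_lt (s := M.s t) hP hPa hw0, sq_nonneg
      ((M.surplusCoef D (t + 1)).meanLin μ (M.s t) (M.P t) 0 0)]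
  · have hy : x - M.target t ≠ 0 := (sub_neg.2 hx).ne
    have hy2 : 0 < (x - M.target t) ^ 2 := by positivity
    simp only [objective_of_lt_target _ hx, mul_le_mul_iff_right₀ hy2] at hw
    rw [policy, if_neg hx.not_ge, ← hum ((x - M.target t)⁻¹ • w), smul_inv_smul₀ hy]
    intro K'
    simpa [inv_smul_smul₀ hy] using hw ((x - M.target t) • K')

end Optimality

section Conditioning

variable [m₀ : MeasurableSpace Ω] {μ : Measure Ω}

variable (M μ) in
/-- The standing assumptions on the market, apart from the continuity of the laws. -/
structure IsMarket : Prop where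
  s_ne_zero : ∀ t < M.T, M.s t ≠ 0
  measurable_P : ∀ t < M.T, Measurable (M.P t)
  memLp_P : ∀ t < M.T, MemLp (M.P t) 2 μ
  filtration_le : ∀ t ≤ M.T, M.𝓕 t ≤ m₀
  indep_P : ∀ t < M.T, Indep (M.𝓕 t) (MeasurableSpace.comap (M.P t) inferInstance) μ

theorem isMarket_of_iIndepFun [IsProbabilityMeasure μ] (hs : ∀ t < M.T, 1 < M.s t)
    (he_meas : ∀ t < M.T, Measurable (M.e t))
    (he_indep : iIndepFun (fun t : Fin M.T => M.e t) μ)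
    (he_L2 : ∀ t < M.T, MemLp (M.e t) 2 μ) : M.IsMarket μ where
  s_ne_zero t ht := (zero_lt_one.trans (hs t ht)).ne'
  measurable_P t ht := PortfolioModel.measurable_P (he_meas t ht)
  memLp_P t ht := PortfolioModel.memLp_P (he_L2 t ht)
  filtration_le t ht := iSup_le fun j => (he_meas j (j.2.trans_le ht)).comap_le
  indep_P t ht := by
    have h := indep_iSup_of_disjoint (fun j : Fin M.T => (he_meas j j.2).comap_le) he_indep.iIndep
      (S := {j | (j : ℕ) < t}) (T := {⟨t, ht⟩}) (by simp)
    refine indep_of_indep_of_le h ?_ ?_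
    · exact iSup_le fun j => le_iSup₂_of_le (⟨j, j.2.trans ht⟩ : Fin M.T) j.2 le_rfl
    · refine le_iSup₂_of_le (⟨t, ht⟩ : Fin M.T) rfl ?_
      have : M.P t = (fun p => p - fun _ => M.s t) ∘ M.e t := rfl
      rw [this, ← MeasurableSpace.comap_comp]
      exact MeasurableSpace.comap_mono
        (measurable_id.sub (measurable_const (a := fun _ : Fin n => M.s t))).comap_le

variable {ξ : Ω → ℝ} {v : ℝ → Fin n → ℝ}

/-- A product of square integrable factors is in general only integrable; here `P_t` and `v (ξ)` are
independent, so the product of their squares is integrable. -/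
theorem IsMarket.memLp_nextWealth (hM : M.IsMarket μ) (ht : t < M.T) (hξ : Measurable[M.𝓕 t] ξ)
    (hξ2 : MemLp ξ 2 μ) (hv : Measurable v) (hv2 : MemLp (fun ω => v (ξ ω)) 2 μ) :
    MemLp (M.nextWealth t ξ v) 2 μ := by
  have hm := hM.filtration_le t ht.le
  have hξm : Measurable ξ := hξ.mono hm le_rfl
  refine (hξ2.const_mul (M.s t)).add
    (memLp_finsetSum (f := fun i ω => M.P t ω i * v (ξ ω) i) _ fun i _ => ?_)
  have hPi := (hM.memLp_P t ht).eval i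
  have hvi := hv2.eval i
  have hind : ξ ⟂ᵢ[μ] M.P t := by
    rw [IndepFun_iff_Indep]
    exact indep_of_indep_of_le_left (hM.indep_P t ht) hξ.comap_le
  have hind' : (fun ω => M.P t ω i ^ 2) ⟂ᵢ[μ] (fun ω => v (ξ ω) i ^ 2) :=
    hind.symm.comp (φ := fun p : Fin n → ℝ => p i ^ 2) (ψ := fun x => v x i ^ 2) (by fun_prop)
      (by fun_prop)
  refine (memLp_two_iff_integrable_sq (hPi.1.mul hvi.1)).2 ?_
  simpa only [Pi.mul_def, mul_pow] using hind'.integrable_mul hPi.integrable_sq hvi.integrable_sq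

variable [IsProbabilityMeasure μ]

theorem IsMarket.condExp_nextSurplus (hM : M.IsMarket μ) (ht : t < M.T)
    (hξ : Measurable[M.𝓕 t] ξ) (hv : Measurable v) {F : ℝ → ℝ} (hF : Measurable F)
    (hint : Integrable (fun ω => F (M.nextWealth t ξ v ω - M.target (t + 1))) μ) :
    μ[fun ω => F (M.nextWealth t ξ v ω - M.target (t + 1)) | M.𝓕 t] =ᵐ[μ] fun ω =>
      ∫ ω', F (nextSurplus (M.s t) (M.P t) (ξ ω - M.target t) (v (ξ ω)) ω') ∂μ := by
  simp only [M.nextWealth_sub_target ht (hM.s_ne_zero t ht)] at hint ⊢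
  refine condExp_freezing (hM.filtration_le t ht.le) hξ (hM.measurable_P t ht) (hM.indep_P t ht)
    (h := fun p => F (M.s t * (p.1 - M.target t) + p.2 ⬝ᵥ v p.1)) (hF.comp ?_) hint
  unfold dotProduct; fun_prop

theorem IsMarket.memLp_policy (D : FundData n) (hξ : Measurable ξ)
    (hξ2 : MemLp ξ 2 μ) : MemLp (fun ω => M.policy D t (ξ ω)) 2 μ :=
  (hξ2.sub (memLp_const (M.target t))).of_le_mul
    ((M.measurable_policy D t).comp hξ).aestronglyMeasurable
    (.of_forall fun ω => M.norm_policy_le D t (ξ ω))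

/-- The conditional moments of the terminal surplus, given the information at time `t`, if the
wealth at time `t` is any `ξ` and the piecewise linear policy is followed. -/
def HasSurplusMoments (M : PortfolioModel Ω n) (μ : Measure Ω) (D : FundData n) (t : ℕ) : Prop :=
  ∀ ξ : Ω → ℝ, Measurable[M.𝓕 t] ξ → MemLp ξ 2 μ →
    MemLp (M.terminalWealth (M.policy D) t ξ) 2 μ ∧
    μ[fun ω => M.terminalWealth (M.policy D) t ξ ω - M.W | M.𝓕 t] =ᵐ[μ]
      (fun ω => (M.surplusCoef D t).lin (ξ ω - M.target t)) ∧
    μ[fun ω => (M.terminalWealth (M.policy D) t ξ ω - M.W) ^ 2 | M.𝓕 t] =ᵐ[μ]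
      (fun ω => (M.surplusCoef D t).quad (ξ ω - M.target t))

/-- Tower property through `𝓕 (t + 1)`, then integration over `P_t` with the wealth frozen. The
control `v` is arbitrary, so this serves both the policy and its deviations. -/
theorem HasSurplusMoments.step {D : FundData n} (hM : M.IsMarket μ) (ht : t < M.T)
    (h : M.HasSurplusMoments μ D (t + 1)) (hξ : Measurable[M.𝓕 t] ξ) (hξ2 : MemLp ξ 2 μ)
    (hv : Measurable v) (hv2 : MemLp (fun ω => v (ξ ω)) 2 μ) :
    MemLp (M.terminalWealth (M.policy D) (t + 1) (M.nextWealth t ξ v)) 2 μ ∧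
    μ[fun ω => M.terminalWealth (M.policy D) (t + 1) (M.nextWealth t ξ v) ω - M.W | M.𝓕 t] =ᵐ[μ]
      (fun ω => (M.surplusCoef D (t + 1)).meanLin μ (M.s t) (M.P t) (ξ ω - M.target t)
        (v (ξ ω))) ∧
    μ[fun ω => (M.terminalWealth (M.policy D) (t + 1) (M.nextWealth t ξ v) ω - M.W) ^ 2 |
        M.𝓕 t] =ᵐ[μ]
      (fun ω => (M.surplusCoef D (t + 1)).meanQuad μ (M.s t) (M.P t) (ξ ω - M.target t)
        (v (ξ ω))) := by
  have hη := hM.memLp_nextWealth ht hξ hξ2 hv hv2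
  obtain ⟨h1, h2, h3⟩ := h _ (M.measurable_nextWealth hξ hv) hη
  have hη' : MemLp (fun ω => M.nextWealth t ξ v ω - M.target (t + 1)) 2 μ :=
    hη.sub (memLp_const _)
  have hle := M.filtration_mono t
  have hle' := hM.filtration_le (t + 1) ht
  refine ⟨h1, ?_, ?_⟩
  · exact (condExp_condExp_of_le hle hle').symm.trans ((condExp_congr_ae h2).trans
      (hM.condExp_nextSurplus ht hξ hv (KinkCoef.continuous_lin _).measurable
        ((KinkCoef.memLp_lin _ hη').integrable one_le_two)))
  · exact (condExp_condExp_of_le hle hle').symm.trans ((condExp_congr_ae h3).trans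
      (hM.condExp_nextSurplus ht hξ hv (KinkCoef.continuous_quad _).measurable
        (KinkCoef.integrable_quad _ hη')))

theorem hasSurplusMoments_T {D : FundData n} (hM : M.IsMarket μ)
    (hT : D.ap M.T = 0 ∧ D.am M.T = 0 ∧ D.bp M.T = 0 ∧ D.bm M.T = 0) :
    M.HasSurplusMoments μ D M.T := by
  intro ξ hξ hξ2
  obtain ⟨h1, h2, h3, h4⟩ := hT
  have hm := hM.filtration_le M.T le_rfl
  have hlin (y : ℝ) : (M.surplusCoef D M.T).lin y = y := by
    rcases le_total 0 y with hy | hy <;> simp [KinkCoef.lin, surplusCoef, ρ_T, h1, h2, hy]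
  have hquad (y : ℝ) : (M.surplusCoef D M.T).quad y = y ^ 2 := by
    rcases le_total 0 y with hy | hy <;>
      simp [KinkCoef.quad, surplusCoef, ρ_T, h1, h2, h3, h4, hy]
  have hsub : MemLp (fun ω => ξ ω - M.W) 2 μ := hξ2.sub (memLp_const _)
  have hsm : StronglyMeasurable[M.𝓕 M.T] fun ω => ξ ω - M.W :=
    (hξ.sub measurable_const).stronglyMeasurable
  simp only [terminalWealth_T, hlin, hquad, target_T]
  refine ⟨hξ2, ?_, ?_⟩
  · exact .of_eq (condExp_of_stronglyMeasurable hm hsm (hsub.integrable one_le_two))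
  · exact .of_eq (condExp_of_stronglyMeasurable hm (hsm.pow 2) hsub.integrable_sq)

theorem hasSurplusMoments {D : FundData n} (hM : M.IsMarket μ)
    (hT : D.ap M.T = 0 ∧ D.am M.T = 0 ∧ D.bp M.T = 0 ∧ D.bm M.T = 0)
    (hD : ∀ t < M.T, M.IsRecursionAt μ D t) (ht : t ≤ M.T) : M.HasSurplusMoments μ D t := by
  induction ht using Nat.decreasingInduction with
  | self => exact hasSurplusMoments_T hM hT
  | of_succ t ht ih =>
    intro ξ hξ hξ2
    have hξm : Measurable ξ := hξ.mono (hM.filtration_le t ht.le) le_rfl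
    have := ih.step hM ht hξ hξ2 (M.measurable_policy D t) (IsMarket.memLp_policy D hξm hξ2)
    simpa only [← M.terminalWealth_eq_nextWealth ht, (hD t ht).meanLin_policy,
      (hD t ht).meanQuad_policy] using this

/-- The cost of following `v` at time `t` and the piecewise linear policy afterwards. -/
theorem HasSurplusMoments.cost_ae_eq {D : FundData n} (hM : M.IsMarket μ) (ht : t < M.T)
    (h : M.HasSurplusMoments μ D (t + 1)) (hξ : Measurable[M.𝓕 t] ξ) (hξ2 : MemLp ξ 2 μ)
    (hv : Measurable v) (hv2 : MemLp (fun ω => v (ξ ω)) 2 μ) {u : ℕ → ℝ → Fin n → ℝ}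
    (hu : ∀ x, u t x = v x) (hu' : ∀ j, t + 1 ≤ j → j < M.T → ∀ x, u j x = M.policy D j x) :
    M.cost μ u t ξ =ᵐ[μ] fun ω =>
      (M.surplusCoef D (t + 1)).objective μ (M.s t) (M.P t) (M.γ t (ξ ω)) (ξ ω - M.target t)
        (v (ξ ω)) - M.γ t (ξ ω) * M.W := by
  obtain ⟨h1, h2, h3⟩ := h.step hM ht hξ hξ2 hv hv2
  have hX : M.terminalWealth u t ξ =
      M.terminalWealth (M.policy D) (t + 1) (M.nextWealth t ξ v) := by
    rw [M.terminalWealth_eq_nextWealth ht, M.terminalWealth_congr ht hu']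
    congr 1
    ext ω
    rw [nextWealth, nextWealth, hu]
  set X := M.terminalWealth (M.policy D) (t + 1) (M.nextWealth t ξ v) with hXdef
  have hm := hM.filtration_le t ht.le
  have hσ : MeasurableSpace.comap ξ inferInstance ≤ M.𝓕 t := hξ.comap_le
  have hσm := hσ.trans hm
  -- Markov property: a conditional moment given `𝓕 t` that is a function of `ξ` is also the one
  -- given `ξ` alone.
  have hcond {Y : Ω → ℝ} {G : ℝ → ℝ} (hG : Measurable G)
      (hY : μ[Y | M.𝓕 t] =ᵐ[μ] fun ω => G (ξ ω)) :
      μ[Y | MeasurableSpace.comap ξ inferInstance] =ᵐ[μ] fun ω => G (ξ ω) := by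
    refine (condExp_condExp_of_le hσ hm).symm.trans ((condExp_congr_ae hY).trans ?_)
    exact .of_eq (condExp_of_stronglyMeasurable hσm
      (hG.comp (comap_measurable ξ)).stronglyMeasurable (integrable_condExp.congr hY))
  have hpair : Measurable fun x => (x - M.target t, v x) :=
    (measurable_id.sub measurable_const).prodMk hv
  have c1 := hcond ((KinkCoef.continuous_meanLin (hM.memLp_P t ht)).measurable.comp hpair) h2
  have c2 := hcond ((KinkCoef.continuous_meanQuad (hM.memLp_P t ht)).measurable.comp hpair) h3
  have hXW : MemLp (fun ω => X ω - M.W) 2 μ := h1.sub (memLp_const _)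
  have hmean : μ[X | MeasurableSpace.comap ξ inferInstance] =ᵐ[μ]
      fun ω => (μ[fun ω => X ω - M.W | MeasurableSpace.comap ξ inferInstance]) ω + M.W := by
    have := condExp_sub (h1.integrable one_le_two) (integrable_const M.W)
      (MeasurableSpace.comap ξ inferInstance)
    rw [condExp_const hσm] at this
    filter_upwards [this] with ω hω
    have hω' : (μ[fun ω => X ω - M.W | MeasurableSpace.comap ξ inferInstance]) ω =
      (μ[X | MeasurableSpace.comap ξ inferInstance]) ω - M.W := hω
    rw [hω']; ring
  -- Shifting by `W` leaves the conditional variance unchanged and moves the mean by `W`; the extra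
  -- cost `-γ W` does not depend on the control.
  have hvar : Var[X; μ | MeasurableSpace.comap ξ inferInstance] =ᵐ[μ]
      Var[fun ω => X ω - M.W; μ | MeasurableSpace.comap ξ inferInstance] := by
    refine condExp_congr_ae ?_
    filter_upwards [hmean] with ω hω
    simp only [Pi.pow_apply, Pi.sub_apply, hω]
    ring
  filter_upwards [c1, c2, hmean, hvar, condVar_ae_eq_condExp_sq_sub_sq_condExp hσm hXW]
    with ω e1 e2 e3 e4 e5
  have e2' : (μ[(fun ω => X ω - M.W) ^ 2 | MeasurableSpace.comap ξ inferInstance]) ω = _ := e2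
  rw [cost, hX, e4, e5, e3]
  simp only [Pi.sub_apply, Pi.pow_apply]
  rw [e1, e2', KinkCoef.objective]
  simp only [Function.comp_apply]
  ring

end Conditioning

end PortfolioModel

/-! ### Assembly of the theorem. -/

theorem theorem1 {Ω : Type*} [MeasurableSpace Ω] (μ : Measure Ω) [IsProbabilityMeasure μ]
    {n : ℕ} (M : PortfolioModel Ω n)
    (hs : ∀ t < M.T, 1 < M.s t)
    (he_meas : ∀ t < M.T, Measurable (M.e t))
    (he_indep : iIndepFun (fun t : Fin M.T => M.e t) μ)
    (he_cont : ∀ t < M.T, μ.map (M.e t) ≪ volume)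
    (he_L2 : ∀ t < M.T, MemLp (M.e t) 2 μ)
    (he_cov : ∀ t < M.T,
      (Matrix.of fun i j : Fin n => cov[fun ω => M.e t ω i, fun ω => M.e t ω j; μ]).PosDef) :
    -- the minimizers and the parameters exist
    (∃ D : FundData n, M.IsBackwardSolution μ D) ∧
    ∀ D : FundData n, M.IsBackwardSolution μ D →
      -- the piecewise linear policy is time consistent
      M.IsTimeConsistent μ (M.policy D) ∧
      -- it is the only one if the minimizers are unique
      ((∀ t < M.T, (∀ K, (∀ K', M.Fp μ D t K ≤ M.Fp μ D t K') → K = D.Kp t) ∧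
          (∀ K, (∀ K', M.Fm μ D t K ≤ M.Fm μ D t K') → K = D.Km t)) →
        ∀ u : ℕ → ℝ → Fin n → ℝ, M.IsTimeConsistent μ u →
          ∀ t < M.T, ∀ x, u t x = M.policy D t x) ∧
      -- the inequalities for the parameters
      (∀ t ≤ M.T, 0 ≤ D.bp t - D.ap t ^ 2 ∧ 0 ≤ D.bm t - D.am t ^ 2) ∧
      -- mean and variance of the terminal wealth, from the initial wealth `x₀`
      ∀ x₀ : ℝ,
        MemLp (M.terminalWealth (M.policy D) 0 (fun _ => x₀)) 2 μ ∧
        ∫ ω, M.terminalWealth (M.policy D) 0 (fun _ => x₀) ω ∂μ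
          = M.ρ 0 * x₀ + (if M.target 0 ≤ x₀ then D.ap 0 else D.am 0) * (x₀ - M.target 0) ∧
        Var[M.terminalWealth (M.policy D) 0 (fun _ => x₀); μ]
          = (if M.target 0 ≤ x₀ then D.bp 0 - D.ap 0 ^ 2 else D.bm 0 - D.am 0 ^ 2)
              * (x₀ - M.target 0) ^ 2 := by
  have hM : M.IsMarket μ := PortfolioModel.isMarket_of_iIndepFun hs he_meas he_indep he_L2
  have hPa : ∀ t < M.T, AtomlessCombinations μ (M.P t) := fun t ht =>
    PortfolioModel.atomlessCombinations_P (he_meas t ht) (he_cont t ht)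
  have hiff (D : FundData n) :=
    PortfolioModel.isBackwardSolution_iff (D := D) hM.measurable_P hM.memLp_P
  refine ⟨?_, fun D hD => ?_⟩
  · obtain ⟨D, hT, hD⟩ := M.exists_isRecursionAt μ hM.s_ne_zero hM.memLp_P hPa (Nat.zero_le M.T)
    exact ⟨D, (hiff D).2 ⟨hT, fun t ht => hD t ht (Nat.zero_le t)⟩⟩
  obtain ⟨hT, hD⟩ := (hiff D).1 hD
  have hvalid {t : ℕ} (ht : t ≤ M.T) : (M.surplusCoef D t).Valid :=
    PortfolioModel.valid_surplusCoef hM.s_ne_zero hM.memLp_P hPa hT (fun t ht _ => hD t ht) ht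
  have hmom {t : ℕ} (ht : t ≤ M.T) : M.HasSurplusMoments μ D t :=
    PortfolioModel.hasSurplusMoments hM hT hD ht
  refine ⟨⟨fun t _ => M.measurable_policy D t, ?_⟩, ?_, ?_, ?_⟩
  · intro t ht ξ hξ hξ2 v hv hv2
    have hξm : Measurable ξ := hξ.mono (hM.filtration_le t ht.le) le_rfl
    filter_upwards [(hmom ht).cost_ae_eq hM ht hξ hξ2 (M.measurable_policy D t)
        (PortfolioModel.IsMarket.memLp_policy D hξm hξ2) (u := M.policy D) (fun _ => rfl)
        (fun _ _ _ _ => rfl),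
      (hmom ht).cost_ae_eq hM ht hξ hξ2 hv hv2 (u := Function.update (M.policy D) t v) (by simp)
        (fun j hj _ x => by rw [Function.update_of_ne (by omega)])] with ω h1 h2
    rw [h1, h2]
    exact sub_le_sub_right ((hD t ht).objective_policy_le (hvalid ht) (hM.memLp_P t ht) _ _) _
  · intro huniq u hu
    -- The cost at `t` can be evaluated only once `u` agrees with the policy at all later times, so
    -- the induction carries them all.
    suffices h : ∀ t ≤ M.T, ∀ j, t ≤ j → j < M.T → ∀ x, u j x = M.policy D j x from
      fun t ht x => h 0 (Nat.zero_le _) t (Nat.zero_le _) ht x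
    intro t ht
    induction ht using Nat.decreasingInduction with
    | self => exact fun j hj hj' => absurd hj' hj.not_gt
    | of_succ t ht ih =>
      intro j hj hjT x
      rcases hj.eq_or_lt with rfl | hlt
      swap
      · exact ih j hlt hjT x
      have hF := huniq t ht
      simp only [PortfolioModel.Fp_eq_objective D (hM.measurable_P t ht) (hM.memLp_P t ht),
        PortfolioModel.Fm_eq_objective D (hM.measurable_P t ht) (hM.memLp_P t ht)] at hF
      refine PortfolioModel.eq_policy_of_forall_objective_le (hvalid ht) (hM.memLp_P t ht)
        (hPa t ht) hF.1 hF.2 fun w => ?_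
      -- For deterministic wealth `x` and a constant control `w`, both sides of the almost sure
      -- inequality reduce to numbers. One sample point therefore suffices, and optimality holds at
      -- every `x`, not merely almost every one.
      have hξ : Measurable[M.𝓕 t] fun _ : Ω => x := measurable_const
      obtain ⟨ω, h1, h2, h3⟩ := ((hu.2 t ht (fun _ => x) hξ (memLp_const x) (fun _ => w)
          measurable_const (memLp_const w)).and
        (((hmom ht).cost_ae_eq hM ht hξ (memLp_const x) (hu.1 t ht) (memLp_const _)
          (u := u) (fun _ => rfl) ih).and
        ((hmom ht).cost_ae_eq hM ht hξ (memLp_const x) (v := fun _ => w) measurable_const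
          (memLp_const w) (u := Function.update u t fun _ => w) (by simp)
          (fun j hj hjT x => by rw [Function.update_of_ne (by omega), ih j hj hjT x])))).exists
      rw [h2, h3] at h1
      exact (sub_le_sub_iff_right _).1 h1
  · intro t ht
    have hp := (hvalid ht).sq_slopePos_le
    have hm := (hvalid ht).sq_slopeNeg_le
    simp only [PortfolioModel.surplusCoef] at hp hm
    -- `(ρ + a)² ≤ ρ² + 2 ρ a + b` is `a² ≤ b`.
    constructor <;> nlinarith
  · intro x₀
    have h0 := Nat.zero_le M.T
    have hξ : Measurable[M.𝓕 0] fun _ : Ω => x₀ := measurable_const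
    obtain ⟨h1, h2, h3⟩ := hmom h0 (fun _ => x₀) hξ (memLp_const x₀)
    set X := M.terminalWealth (M.policy D) 0 fun _ => x₀ with hX
    have hm := hM.filtration_le 0 h0
    have e1 : ∫ ω, (X ω - M.W) ∂μ = (M.surplusCoef D 0).lin (x₀ - M.target 0) := by
      rw [← integral_condExp hm, integral_congr_ae h2]
      simp
    have e2 : ∫ ω, (X ω - M.W) ^ 2 ∂μ = (M.surplusCoef D 0).quad (x₀ - M.target 0) := by
      rw [← integral_condExp hm, integral_congr_ae h3]
      simp
    have hXW : MemLp (fun ω => X ω - M.W) 2 μ := h1.sub (memLp_const _)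
    have hmean : ∫ ω, X ω ∂μ = (M.surplusCoef D 0).lin (x₀ - M.target 0) + M.W := by
      rw [← e1, integral_sub (h1.integrable one_le_two) (integrable_const _)]
      simp
    have hvar : Var[X; μ] = (M.surplusCoef D 0).quad (x₀ - M.target 0) -
        (M.surplusCoef D 0).lin (x₀ - M.target 0) ^ 2 := by
      rw [← variance_sub_const h1.1 M.W, variance_eq_sub hXW, ← e1, ← e2]
      rfl
    -- This turns `(ρ_0 + a_0) (x₀ - target) + W` into `ρ_0 x₀ + a_0 (x₀ - target)`.
    have hρ : M.ρ 0 * M.target 0 = M.W := by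
      have : M.ρ 0 ≠ 0 := Finset.prod_ne_zero_iff.2 fun t ht =>
        hM.s_ne_zero t (Finset.mem_Ico.1 ht).2
      rw [PortfolioModel.target, mul_inv_cancel_left₀ this]
    refine ⟨h1, ?_, ?_⟩
    · rw [hmean, ← hρ]
      split_ifs with hx
      · rw [KinkCoef.lin_of_nonneg _ (sub_nonneg.2 hx)]
        simp only [PortfolioModel.surplusCoef]
        ring
      · rw [KinkCoef.lin_of_nonpos _ (sub_nonpos.2 (not_le.1 hx).le)]
        simp only [PortfolioModel.surplusCoef]
        ring
    · rw [hvar]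
      split_ifs with hx
      · rw [KinkCoef.lin_of_nonneg _ (sub_nonneg.2 hx), KinkCoef.quad_of_nonneg _ (sub_nonneg.2 hx)]
        simp only [PortfolioModel.surplusCoef]
        ring
      · have hx' := sub_nonpos.2 (not_le.1 hx).le
        rw [KinkCoef.lin_of_nonpos _ hx', KinkCoef.quad_of_nonpos _ hx']
        simp only [PortfolioModel.surplusCoef]
        ring
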